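/- For $\nu,x\in\mathbb C$ let $D_\nu(x)$ be the parabolic cylinder function, i.e. the solution of $-y''+\left(\frac{x^2}{4}-\frac12\right)y=\nu y$ with $D_\nu(0)=\frac{2^{\nu/2}\sqrt\pi}{\Gamma\left(\frac{1-\nu}{2}\right)}$ and $D_\nu'(0)=-\frac{2^{(\nu+1)/2}\sqrt\pi}{\Gamma\left(-\frac{\nu}{2}\right)}$, where $1/\Gamma$ denotes the entire reciprocal Gamma function. For $b>0$ and $z\in\mathbb C$ let $$L_{z,b}=-\frac{d^2}{dx^2}+\left(\frac{x^2}{4}-\frac12\right)+z\left[\delta(x-b)-\delta(x+b)\right]$$ be the operator on $L^2(\mathbb R)$ associated with the form $$t_{z,b}(f,g)=\langle f',g'\rangle+\tfrac14\langle xf,xg\rangle-\tfrac12\langle f,g\rangle+z\left(f(b)\overline{g(b)}-f(-b)\overline{g(-b)}\right)$$ with form domain $\{f\in H^1(\mathbb R): xf\in L^2(\mathbb R)\}$, where $\langle f,g\rangle=\int_{\mathbb R} f\overline g$. That is, $u$ lies in the domain of $L_{z,b}$ and $L_{z,b}u=h$ if and only if $u$ lies in the form domain, $h\in L^2(\mathbb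 R)$, and $t_{z,b}(u,g)=\langle h,g\rangle$ for all $g$ in the form domain. Fix $b>0$, let $n\in\mathbb N$ satisfy $D_n(b)=0$, and let $\rho>0$. Then there is a constant $\delta>0$ (depending on $b$, $n$ and $\rho$) such that for every real $r>1/\delta$ the operator $L_{ir,b}$ has two distinct non-real eigenvalues $\nu$ with $|\nu-n|<\rho$. -/

import Mathlib

open MeasureTheory ComplexConjugate
open scoped ContDiff

noncomputable section

/-- The even solution of `-y'' + (x^2/4 - 1/2) y = ν y` with `y(0) = 1`, `y'(0) = 0`:
`e^{-x²/4} [1 + (-ν) x²/2! + (-ν)(-ν+2) x⁴/4! + ⋯]`. -/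
def weberEven (ν x : ℂ) : ℂ :=
  Complex.exp (-x ^ 2 / 4) *
    ∑' k : ℕ, (∏ j ∈ Finset.range k, (-ν + 2 * (j : ℂ))) * x ^ (2 * k) /
      (Nat.factorial (2 * k) : ℂ)

/-- The odd solution of `-y'' + (x^2/4 - 1/2) y = ν y` with `y(0) = 0`, `y'(0) = 1`:
`e^{-x²/4} [x + (-ν+1) x³/3! + (-ν+1)(-ν+3) x⁵/5! + ⋯]`. -/
def weberOdd (ν x : ℂ) : ℂ :=
  Complex.exp (-x ^ 2 / 4) *
    ∑' k : ℕ, (∏ j ∈ Finset.range k, (-ν + 1 + 2 * (j : ℂ))) * x ^ (2 * k + 1) /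
      (Nat.factorial (2 * k + 1) : ℂ)

/-- The parabolic cylinder function `D_ν(x)`: the solution of the Weber equation with
`D_ν(0) = 2^{ν/2} √π / Γ((1-ν)/2)` and `D_ν'(0) = -2^{(ν+1)/2} √π / Γ(-ν/2)`.
`Complex.Gamma` takes the value `0` at its poles, so `(Complex.Gamma s)⁻¹` is the entire
function `1/Γ(s)` for every `s`. -/
def parabolicCylinderD (ν x : ℂ) : ℂ :=
  (2 : ℂ) ^ (ν / 2) * (Real.sqrt Real.pi : ℂ) * (Complex.Gamma (-ν / 2 + 1 / 2))⁻¹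
      * weberEven ν x
    - (2 : ℂ) ^ ((ν + 1) / 2) * (Real.sqrt Real.pi : ℂ) * (Complex.Gamma (-ν / 2))⁻¹
      * weberOdd ν x

/-- `f'` is the weak derivative of `f` on the real line (tested against `C_c^∞`). -/
def HasWeakDerivative (f f' : ℝ → ℂ) : Prop :=
  ∀ φ : ℝ → ℝ, ContDiff ℝ ∞ φ → HasCompactSupport φ →
    ∫ x, deriv φ x • f x = - ∫ x, φ x • f' x

/-- The form domain `{f ∈ H¹(ℝ) : x f(x) ∈ L²(ℝ)}`. An element of `H¹(ℝ)` is given by its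
(unique) continuous representative, together with its (a.e. unique) weak derivative. -/
structure PCFormDomain where
  toFun : ℝ → ℂ
  wderiv : ℝ → ℂ
  continuous_toFun : Continuous toFun
  hasWeakDerivative : HasWeakDerivative toFun wderiv
  memLp_toFun : MemLp toFun 2 volume
  memLp_wderiv : MemLp wderiv 2 volume
  memLp_mul : MemLp (fun x : ℝ => (x : ℂ) * toFun x) 2 volume

/-- The quadratic (sesquilinear) form
`⟨f', g'⟩ + ¼ ⟨x f, x g⟩ - ½ ⟨f, g⟩ + z (f(b) conj g(b) - f(-b) conj g(-b))`,
where `⟨f, g⟩ = ∫ f conj g`. -/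
def pcForm (z : ℂ) (b : ℝ) (f g : PCFormDomain) : ℂ :=
  (∫ x, f.wderiv x * conj (g.wderiv x))
    + 1 / 4 * (∫ x : ℝ, ((x : ℂ) * f.toFun x) * conj ((x : ℂ) * g.toFun x))
    - 1 / 2 * (∫ x, f.toFun x * conj (g.toFun x))
    + z * (f.toFun b * conj (g.toFun b) - f.toFun (-b) * conj (g.toFun (-b)))

lemma HasWeakDerivative.ae_zero {f' : ℝ → ℂ} (h : HasWeakDerivative (fun _ => 0) f')
    (hf' : MemLp f' 2 volume) : f' =ᵐ[volume] 0 := by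
  refine ae_eq_zero_of_integral_contDiff_smul_eq_zero
    (hf'.locallyIntegrable (by norm_num)) fun φ hφ hc => ?_
  have := h φ hφ hc
  simpa using this.symm

/-- Smooth compactly supported functions lie in the form domain. -/
def PCFormDomain.ofTest (φ : ℝ → ℝ) (hφ : ContDiff ℝ ∞ φ) (hc : HasCompactSupport φ) :
    PCFormDomain where
  toFun x := (φ x : ℂ)
  wderiv x := ((deriv φ x : ℝ) : ℂ)
  continuous_toFun := Complex.continuous_ofReal.comp hφ.continuous
  hasWeakDerivative := by
    intro ψ hψ hψc
    have hd : Continuous (deriv φ) := hφ.continuous_deriv (by simp)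
    have hd' : Continuous (deriv ψ) := hψ.continuous_deriv (by simp)
    have key : ∫ x, ψ x * deriv φ x = - ∫ x, deriv ψ x * φ x := by
      refine integral_mul_deriv_eq_deriv_mul_of_integrable
        (fun x _ => (hψ.differentiable (by simp) x).hasDerivAt)
        (fun x _ => (hφ.differentiable (by simp) x).hasDerivAt) ?_ ?_ ?_
      · exact (hψ.continuous.mul hd).integrable_of_hasCompactSupport hψc.mul_right
      · exact (hd'.mul hφ.continuous).integrable_of_hasCompactSupport hc.mul_left
      · exact (hψ.continuous.mul hφ.continuous).integrable_of_hasCompactSupport hψc.mul_right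
    have e1 : ∀ x, deriv ψ x • (φ x : ℂ) = ((deriv ψ x * φ x : ℝ) : ℂ) := by
      intro x; simp
    have e2 : ∀ x, ψ x • ((deriv φ x : ℝ) : ℂ) = ((ψ x * deriv φ x : ℝ) : ℂ) := by
      intro x; simp
    simp only [e1, e2]
    rw [integral_complex_ofReal, integral_complex_ofReal, key]
    simp
  memLp_toFun :=
    (Complex.continuous_ofReal.comp hφ.continuous).memLp_of_hasCompactSupport
      (hc.comp_left Complex.ofReal_zero)
  memLp_wderiv :=
    (Complex.continuous_ofReal.comp (hφ.continuous_deriv (by simp))).memLp_of_hasCompactSupport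
      (hc.deriv.comp_left Complex.ofReal_zero)
  memLp_mul :=
    (Complex.continuous_ofReal.mul
      (Complex.continuous_ofReal.comp hφ.continuous)).memLp_of_hasCompactSupport
      (hc.comp_left (g := ((↑) : ℝ → ℂ)) Complex.ofReal_zero).mul_left

lemma integrable_mul_conj {f g : ℝ → ℂ} (hf : MemLp f 2 volume) (hg : MemLp g 2 volume) :
    Integrable (fun x => f x * conj (g x)) volume :=
  hf.integrable_mul hg.star

lemma HasWeakDerivative.add {f f' g g' : ℝ → ℂ} (hf : HasWeakDerivative f f')
    (hg : HasWeakDerivative g g') (fL : MemLp f 2 volume) (fL' : MemLp f' 2 volume)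
    (gL : MemLp g 2 volume) (gL' : MemLp g' 2 volume) :
    HasWeakDerivative (f + g) (f' + g') := by
  intro φ hφ hc
  have hd : Continuous (deriv φ) := hφ.continuous_deriv (by simp)
  have i : ∀ (ψ : ℝ → ℝ) (u : ℝ → ℂ), Continuous ψ → HasCompactSupport ψ → MemLp u 2 volume →
      Integrable (fun x => ψ x • u x) volume := fun ψ u h1 h2 h3 =>
    (h3.locallyIntegrable (by norm_num)).integrable_smul_left_of_hasCompactSupport h1 h2
  simp only [Pi.add_apply, smul_add]
  rw [integral_add (i _ _ hd hc.deriv fL) (i _ _ hd hc.deriv gL),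
    integral_add (i _ _ hφ.continuous hc fL') (i _ _ hφ.continuous hc gL'),
    hf φ hφ hc, hg φ hφ hc]
  ring

def PCFormDomain.add (f g : PCFormDomain) : PCFormDomain where
  toFun := f.toFun + g.toFun
  wderiv := f.wderiv + g.wderiv
  continuous_toFun := f.continuous_toFun.add g.continuous_toFun
  hasWeakDerivative := f.hasWeakDerivative.add g.hasWeakDerivative f.memLp_toFun f.memLp_wderiv
    g.memLp_toFun g.memLp_wderiv
  memLp_toFun := f.memLp_toFun.add g.memLp_toFun
  memLp_wderiv := f.memLp_wderiv.add g.memLp_wderiv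
  memLp_mul := by
    refine (f.memLp_mul.add g.memLp_mul).congr_norm ?_ ?_
    · exact (Complex.continuous_ofReal.mul
        (f.continuous_toFun.add g.continuous_toFun)).aestronglyMeasurable
    · exact Filter.Eventually.of_forall fun x => by simp [mul_add]

def PCFormDomain.smul (c : ℂ) (f : PCFormDomain) : PCFormDomain where
  toFun := c • f.toFun
  wderiv := c • f.wderiv
  continuous_toFun := f.continuous_toFun.const_smul c
  hasWeakDerivative := by
    intro φ hφ hc
    simp only [Pi.smul_apply, smul_comm _ c]
    rw [integral_smul, integral_smul, f.hasWeakDerivative φ hφ hc, smul_neg]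
  memLp_toFun := f.memLp_toFun.const_smul c
  memLp_wderiv := f.memLp_wderiv.const_smul c
  memLp_mul := by
    refine (f.memLp_mul.const_smul c).congr_norm ?_ ?_
    · exact (Complex.continuous_ofReal.mul
        (f.continuous_toFun.const_smul c)).aestronglyMeasurable
    · exact Filter.Eventually.of_forall fun x => by simp [mul_left_comm]

lemma pcForm_add (z : ℂ) (b : ℝ) (f₁ f₂ g : PCFormDomain) :
    pcForm z b (f₁.add f₂) g = pcForm z b f₁ g + pcForm z b f₂ g := by
  simp only [pcForm, PCFormDomain.add, Pi.add_apply, mul_add, add_mul]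
  rw [integral_add (integrable_mul_conj f₁.memLp_wderiv g.memLp_wderiv)
      (integrable_mul_conj f₂.memLp_wderiv g.memLp_wderiv),
    integral_add (integrable_mul_conj f₁.memLp_toFun g.memLp_toFun)
      (integrable_mul_conj f₂.memLp_toFun g.memLp_toFun),
    integral_add (integrable_mul_conj f₁.memLp_mul g.memLp_mul)
      (integrable_mul_conj f₂.memLp_mul g.memLp_mul)]
  ring

lemma pcForm_smul (z : ℂ) (b : ℝ) (c : ℂ) (f g : PCFormDomain) :
    pcForm z b (f.smul c) g = c * pcForm z b f g := by
  have e : ∀ x : ℝ, (x : ℂ) * (c * f.toFun x) * conj ((x : ℂ) * g.toFun x)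
      = c * ((x : ℂ) * f.toFun x * conj ((x : ℂ) * g.toFun x)) := fun x => by ring
  simp only [pcForm, PCFormDomain.smul, Pi.smul_apply, smul_eq_mul, e]
  simp only [mul_assoc c, integral_const_mul]
  ring

/-- The graph of the operator associated with the form: `(u, h)` belongs to it iff `u` lies in
the form domain and `t(u, g) = ⟨h, g⟩` for all `g` in the form domain. -/
def pcGraph (z : ℂ) (b : ℝ) :
    Submodule ℂ (Lp ℂ 2 (volume : Measure ℝ) × Lp ℂ 2 (volume : Measure ℝ)) where
  carrier := {p | ∃ f : PCFormDomain, (p.1 : ℝ → ℂ) =ᵐ[volume] f.toFun ∧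
    ∀ g : PCFormDomain, ∫ x, p.2 x * conj (g.toFun x) = pcForm z b f g}
  add_mem' := by
    rintro ⟨u, h⟩ ⟨v, k⟩ ⟨f, hf, hf'⟩ ⟨g, hg, hg'⟩
    refine ⟨f.add g, (Lp.coeFn_add u v).trans (hf.add hg), fun w => ?_⟩
    rw [pcForm_add, ← hf', ← hg',
      ← integral_add (integrable_mul_conj (Lp.memLp h) w.memLp_toFun)
        (integrable_mul_conj (Lp.memLp k) w.memLp_toFun)]
    refine integral_congr_ae ?_
    filter_upwards [Lp.coeFn_add h k] with x hx
    change (h + k : Lp ℂ 2 volume) x * _ = _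
    rw [hx, Pi.add_apply, add_mul]
  zero_mem' := by
    refine ⟨⟨0, 0, continuous_const, fun φ _ _ => by simp, MemLp.zero, MemLp.zero, by simp⟩,
      Lp.coeFn_zero _ _ _, fun w => ?_⟩
    have : ∫ x, (0 : Lp ℂ 2 (volume : Measure ℝ)) x * conj (w.toFun x) = 0 := by
      refine integral_eq_zero_of_ae ?_
      filter_upwards [Lp.coeFn_zero ℂ 2 (volume : Measure ℝ)] with x hx
      rw [hx, Pi.zero_apply, zero_mul]
    exact this.trans (by simp [pcForm])
  smul_mem' := by
    rintro c ⟨u, h⟩ ⟨f, hf, hf'⟩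
    refine ⟨f.smul c, (Lp.coeFn_smul c u).trans (hf.const_smul c), fun w => ?_⟩
    rw [pcForm_smul, ← hf', ← integral_const_mul]
    refine integral_congr_ae ?_
    filter_upwards [Lp.coeFn_smul c h] with x hx
    change (c • h : Lp ℂ 2 volume) x * _ = _
    rw [hx, Pi.smul_apply, smul_eq_mul, mul_assoc]

/-- The graph is single-valued, so the operator below is well defined. -/
lemma pcGraph_functional (z : ℂ) (b : ℝ)
    (p : Lp ℂ 2 (volume : Measure ℝ) × Lp ℂ 2 (volume : Measure ℝ))
    (hp : p ∈ pcGraph z b) (h0 : p.1 = 0) : p.2 = 0 := by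
  obtain ⟨f, hf, hf'⟩ := hp
  rw [h0] at hf
  have hf0 : f.toFun = fun _ => 0 := by
    refine (Continuous.ae_eq_iff_eq volume f.continuous_toFun continuous_const).mp ?_
    exact hf.symm.trans (Lp.coeFn_zero ℂ 2 (volume : Measure ℝ))
  have hd0 : f.wderiv =ᵐ[volume] 0 :=
    HasWeakDerivative.ae_zero (hf0 ▸ f.hasWeakDerivative) f.memLp_wderiv
  have hz : ∀ g, pcForm z b f g = 0 := by
    intro g
    have : ∫ x, f.wderiv x * conj (g.wderiv x) = 0 := by
      refine integral_eq_zero_of_ae ?_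
      filter_upwards [hd0] with x hx
      simp [hx]
    simp [pcForm, hf0, this]
  rw [Lp.eq_zero_iff_ae_eq_zero]
  refine ae_eq_zero_of_integral_contDiff_smul_eq_zero
    ((Lp.memLp p.2).locallyIntegrable (by norm_num)) fun φ hφ hc => ?_
  rw [← (hf' (.ofTest φ hφ hc)).trans (hz _)]
  refine integral_congr_ae (Filter.Eventually.of_forall fun x => ?_)
  simp [PCFormDomain.ofTest, mul_comm]

/-- The operator `-d²/dx² + (x²/4 - 1/2) + z (δ(x - b) - δ(x + b))` on `L²(ℝ)`, i.e. the
unbounded operator associated with the form `pcForm z b`: its domain consists of those `u` in the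
form domain for which there is an `h ∈ L²(ℝ)` with `t(u, g) = ⟨h, g⟩` for all `g` in the form
domain, and it sends `u` to `h`. -/
def pcOperator (z : ℂ) (b : ℝ) :
    Lp ℂ 2 (volume : Measure ℝ) →ₗ.[ℂ] Lp ℂ 2 (volume : Measure ℝ) :=
  (pcGraph z b).toLinearPMap

/-- The graph of `pcOperator` is `pcGraph`. -/
lemma pcOperator_graph (z : ℂ) (b : ℝ) : (pcOperator z b).graph = pcGraph z b :=
  Submodule.toLinearPMap_graph_eq _ fun p hp h0 => pcGraph_functional z b p hp h0

/-- `μ` is an eigenvalue of the unbounded operator `T`. -/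
def IsEigenvalue {E : Type*} [AddCommGroup E] [Module ℂ E] (T : E →ₗ.[ℂ] E) (μ : ℂ) : Prop :=
  ∃ u : T.domain, (u : E) ≠ 0 ∧ T u = μ • (u : E)

end

/-! Let `y_ν` be the solution of the Weber equation that decays at `+∞`; then `y_ν(-x)` decays at
`-∞`. An eigenfunction can be sought as a combination of two continuous functions, each glued from
multiples of `y_ν(x)` and `y_ν(-x)`, one with a kink at `b` and one with a kink at `-b`. The kinks
must cancel the two delta terms, a 2×2 linear system whose determinant vanishes when `w² = z² A² (C²
- A²)`, where `A = y_ν(b)`, `C = y_ν(-b)` and `w` is, up to sign, the Wronskian of `y_ν(x)` and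
`y_ν(-x)` (`isEigenvalue_of_matching`).

At `ν = n` the solution is the Hermite function, so `D_n(b) = 0` and parity make `A`, `C` and `w`
all vanish. With `ν = n + ε`, `A = ε a`, `C = ε c` and `w` replaced by `ε w`, the condition for `z =
ir` becomes `r² ε² g(ε) = -1` with `g = a² (c² - a²) / w²` analytic at `0`. Lagrange's identity on
half-lines (`deriv_weberY_left_mul`) expresses `a(0)` and `c(0)` through the integrals `I₁ < I₂` of
the squared eigenfunction over `(b, ∞)` and `(-b, ∞)`. Hence `g(0) > 0`, and for large `r` there are
two solutions `ε ≈ ± i / (r √g(0))`, which are not real (`exists_nonreal_roots`).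

What remains is to supply `y_ν` analytically in `ν` with Gaussian bounds (`weberU`,
`isWeberSolution_weberY`), to integrate by parts against weak derivatives
(`HasWeakDerivative.integral_eq_sub`, `pcForm_glue`), and to see that a zero of `D_n` is a zero of
the Hermite function (`hermiteFun_eq_zero_of_parabolicCylinderD`). -/

/-! ### The Mellin transform of the Gaussian kernel. -/

/-- The kernel `e^{-xt - t²/2}` of the integral representation of the Weber functions. -/
noncomputable def gaussKernel (x t : ℝ) : ℝ := Real.exp (-(x * t) - t ^ 2 / 2)

/-- `∫_0^∞ t^{s-1} e^{-xt - t²/2} dt`. -/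
noncomputable def gaussMellin (s : ℂ) (x : ℝ) : ℂ := mellin (fun t => (gaussKernel x t : ℂ)) s

lemma gaussKernel_pos (x t : ℝ) : 0 < gaussKernel x t := Real.exp_pos _

lemma continuous_gaussKernel (x : ℝ) : Continuous (gaussKernel x) := by
  unfold gaussKernel; fun_prop

lemma gaussKernel_le (x t : ℝ) : gaussKernel x t ≤ Real.exp ((1 - x) ^ 2 / 2) * Real.exp (-1 * t) := by
  rw [gaussKernel, ← Real.exp_add]
  -- Completing the square: the difference of the exponents is `(t - (1 - x))² / 2`.
  exact Real.exp_le_exp.2 (by nlinarith [sq_nonneg (t - (1 - x))])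

lemma gaussKernel_anti {x y t : ℝ} (hxy : x ≤ y) (ht : 0 ≤ t) : gaussKernel y t ≤ gaussKernel x t :=
  Real.exp_le_exp.2 (by nlinarith [mul_le_mul_of_nonneg_right hxy ht])

lemma gaussKernel_isBigO_atTop (x : ℝ) :
    (fun t => (gaussKernel x t : ℂ)) =O[Filter.atTop] fun t => Real.exp (-1 * t) := by
  refine Asymptotics.IsBigO.of_bound (Real.exp ((1 - x) ^ 2 / 2)) (Filter.Eventually.of_forall fun t => ?_)
  rw [Complex.norm_real, Real.norm_of_nonneg (gaussKernel_pos x t).le,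
    Real.norm_of_nonneg (Real.exp_pos _).le]
  exact gaussKernel_le x t

lemma gaussKernel_isBigO_zero (x : ℝ) :
    (fun t => (gaussKernel x t : ℂ)) =O[nhdsWithin 0 (Set.Ioi 0)] fun t => t ^ (-(0 : ℝ)) := by
  simp only [neg_zero, Real.rpow_zero]
  refine Filter.Tendsto.isBigO_one ℝ (c := (gaussKernel x 0 : ℂ)) ?_
  exact ((Complex.continuous_ofReal.comp (continuous_gaussKernel x)).tendsto 0).mono_left
    nhdsWithin_le_nhds

lemma locallyIntegrableOn_gaussKernel (x : ℝ) :
    LocallyIntegrableOn (fun t => (gaussKernel x t : ℂ)) (Set.Ioi 0) :=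
  ((Complex.continuous_ofReal.comp (continuous_gaussKernel x)).locallyIntegrable).locallyIntegrableOn _

lemma mellinConvergent_gaussKernel {s : ℂ} (hs : 0 < s.re) (x : ℝ) :
    MellinConvergent (fun t => (gaussKernel x t : ℂ)) s :=
  mellinConvergent_of_isBigO_rpow_exp one_pos (locallyIntegrableOn_gaussKernel x)
    (gaussKernel_isBigO_atTop x) (gaussKernel_isBigO_zero x) hs

lemma differentiableAt_gaussMellin {s : ℂ} (hs : 0 < s.re) (x : ℝ) :
    DifferentiableAt ℂ (fun s => gaussMellin s x) s :=
  mellin_differentiableAt_of_isBigO_rpow_exp one_pos (locallyIntegrableOn_gaussKernel x)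
    (gaussKernel_isBigO_atTop x) (gaussKernel_isBigO_zero x) hs

lemma norm_mellinIntegrand_gaussKernel (s : ℂ) (x : ℝ) {t : ℝ} (ht : 0 < t) :
    ‖(t : ℂ) ^ (s - 1) • (gaussKernel x t : ℂ)‖ = t ^ (s.re - 1) * gaussKernel x t := by
  rw [norm_smul, Complex.norm_cpow_eq_rpow_re_of_pos ht, Complex.norm_real,
    Real.norm_of_nonneg (gaussKernel_pos x t).le]
  simp

lemma integrableOn_rpow_mul_gaussKernel {σ : ℝ} (hσ : 0 < σ) (x : ℝ) :
    IntegrableOn (fun t => t ^ (σ - 1) * gaussKernel x t) (Set.Ioi 0) := by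
  have h := (mellinConvergent_gaussKernel (s := (σ : ℂ)) (by simpa using hσ) x).norm
  refine (integrableOn_congr_fun (fun t ht => ?_) measurableSet_Ioi).1 h
  rw [norm_mellinIntegrand_gaussKernel _ _ ht, Complex.ofReal_re]

lemma hasDerivAt_gaussKernel_left (x t : ℝ) :
    HasDerivAt (fun x => gaussKernel x t) (-t * gaussKernel x t) x := by
  have h : HasDerivAt (fun x : ℝ => -(x * t) - t ^ 2 / 2) (-t) x := by
    simpa using (((hasDerivAt_id x).mul_const t).neg).sub_const (t ^ 2 / 2)
  have h2 := h.exp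
  rw [mul_comm] at h2
  exact h2

lemma hasDerivAt_gaussKernel (x t : ℝ) :
    HasDerivAt (gaussKernel x) (-(x + t) * gaussKernel x t) t := by
  have h : HasDerivAt (fun t : ℝ => -(x * t) - t ^ 2 / 2) (-(x + t)) t := by
    have := (((hasDerivAt_id t).const_mul x).neg).sub (((hasDerivAt_id t).pow 2).div_const 2)
    exact this.congr_deriv (by simp; ring)
  have h2 := h.exp
  rw [mul_comm] at h2
  exact h2

lemma cpow_eq_mul_cpow_sub_one (s : ℂ) {t : ℝ} (ht : 0 < t) :
    (t : ℂ) ^ s = t * (t : ℂ) ^ (s - 1) := by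
  have ht' : (t : ℂ) ≠ 0 := by exact_mod_cast ht.ne'
  rw [Complex.cpow_sub _ _ ht', Complex.cpow_one]
  field_simp

lemma hasDerivAt_gaussMellin {s : ℂ} (hs : 0 < s.re) (x : ℝ) :
    HasDerivAt (fun x => gaussMellin s x) (-gaussMellin (s + 1) x) x := by
  have hs1 : 0 < (s + 1).re := by simp; linarith
  -- The kernel decreases in `x` for `t ≥ 0`, so on the unit ball around `x` its value at `x - 1`
  -- dominates.
  have key := hasDerivAt_integral_of_dominated_loc_of_deriv_le (𝕜 := ℝ) (x₀ := x)
    (μ := volume.restrict (Set.Ioi (0 : ℝ))) (s := Metric.ball x 1)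
    (F := fun x t => (t : ℂ) ^ (s - 1) • (gaussKernel x t : ℂ))
    (F' := fun x t => -((t : ℂ) ^ (s + 1 - 1) • (gaussKernel x t : ℂ)))
    (bound := fun t => t ^ ((s + 1).re - 1) * gaussKernel (x - 1) t)
    (Metric.ball_mem_nhds x one_pos)
    (Filter.Eventually.of_forall fun y => (mellinConvergent_gaussKernel hs y).aestronglyMeasurable)
    (mellinConvergent_gaussKernel hs x)
    (mellinConvergent_gaussKernel hs1 x).aestronglyMeasurable.neg ?_
    (integrableOn_rpow_mul_gaussKernel hs1 (x - 1)) ?_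
  · have := key.2
    rw [integral_neg] at this
    exact this
  · filter_upwards [ae_restrict_mem measurableSet_Ioi] with t ht y hy
    rw [norm_neg, norm_mellinIntegrand_gaussKernel _ _ ht]
    have : x - 1 ≤ y := by
      rw [Metric.mem_ball, Real.dist_eq] at hy; linarith [(abs_lt.1 hy).1]
    exact mul_le_mul_of_nonneg_left (gaussKernel_anti this (le_of_lt ht))
      (Real.rpow_nonneg (le_of_lt ht) _)
  · filter_upwards [ae_restrict_mem measurableSet_Ioi] with t ht y _
    have := (hasDerivAt_gaussKernel_left y t).ofReal_comp.const_mul ((t : ℂ) ^ (s - 1))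
    refine this.congr_deriv ?_
    rw [show s + 1 - 1 = s by ring, cpow_eq_mul_cpow_sub_one s ht]
    simp only [smul_eq_mul]; push_cast; ring

/-- Integrate the `t`-derivative of `t^s e^{-xt - t²/2}` over the half-line; both boundary terms
vanish because `Re s > 0`. -/
lemma gaussMellin_recurrence {s : ℂ} (hs : 0 < s.re) (x : ℝ) :
    gaussMellin (s + 2) x + x * gaussMellin (s + 1) x = s * gaussMellin s x := by
  have hs0 : s ≠ 0 := by rintro rfl; simp at hs
  have hs1 : 0 < (s + 1).re := by simp; linarith
  have hs2 : 0 < (s + 2).re := by simp; linarith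
  have c0 := mellinConvergent_gaussKernel hs x
  have c1 := mellinConvergent_gaussKernel hs1 x
  have c2 := mellinConvergent_gaussKernel hs2 x
  have hint := ((c0.const_mul s).sub (c1.const_mul (x : ℂ))).sub c2
  have key := MeasureTheory.integral_Ioi_of_hasDerivAt_of_tendsto (a := 0) (m := (0 : ℂ))
    (f := fun t : ℝ => (t : ℂ) ^ s * (gaussKernel x t : ℂ)) ?_ ?_ hint ?_
  · have key := (integral_sub ((c0.const_mul s).sub (c1.const_mul (x : ℂ))) c2).symm.trans key
    have e := integral_sub (c0.const_mul s) (c1.const_mul (x : ℂ))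
    simp only [integral_const_mul] at e
    replace key := (congrArg (· - gaussMellin (s + 2) x) e).symm.trans key
    simp only [Complex.ofReal_zero, Complex.zero_cpow hs0, zero_mul, sub_zero] at key
    change s * gaussMellin s x - x * gaussMellin (s + 1) x - gaussMellin (s + 2) x = 0 at key
    linear_combination -key
  · refine (ContinuousAt.mul ?_ ?_).continuousWithinAt
    · exact Complex.continuousAt_ofReal_cpow_const _ _ (Or.inl hs)
    · exact (Complex.continuous_ofReal.comp (continuous_gaussKernel x)).continuousAt
  · intro t ht
    have h1 := (hasDerivAt_id (t : ℂ)).cpow_const (c := s) (by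
      left; simpa using ht)
    have h1' : HasDerivAt (fun t : ℝ => (t : ℂ) ^ s) (s * (t : ℂ) ^ (s - 1)) t := by
      simpa using h1.comp_ofReal
    have h2 := h1'.mul (hasDerivAt_gaussKernel x t).ofReal_comp
    refine h2.congr_deriv ?_
    simp only [Pi.sub_apply, smul_eq_mul]
    rw [show s + 1 - 1 = s by ring, show s + 2 - 1 = s + 1 by ring,
      cpow_eq_mul_cpow_sub_one (s + 1) ht, show s + 1 - 1 = s by ring]
    push_cast; ring
  · rw [tendsto_zero_iff_norm_tendsto_zero]
    have hlim := (tendsto_rpow_mul_exp_neg_mul_atTop_nhds_zero s.re 1 one_pos).const_mul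
      (Real.exp ((1 - x) ^ 2 / 2))
    rw [mul_zero] at hlim
    refine squeeze_zero' (Filter.Eventually.of_forall fun t => norm_nonneg _) ?_ hlim
    filter_upwards [Filter.eventually_gt_atTop 0] with t ht
    rw [norm_mul, Complex.norm_cpow_eq_rpow_re_of_pos ht, Complex.norm_real,
      Real.norm_of_nonneg (gaussKernel_pos x t).le]
    calc _ ≤ t ^ s.re * (Real.exp ((1 - x) ^ 2 / 2) * Real.exp (-1 * t)) :=
          mul_le_mul_of_nonneg_left (gaussKernel_le x t) (Real.rpow_nonneg ht.le _)
      _ = _ := by ring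

/-- The bound is uniform both in `s` near `s₀` and in `x ≥ c`; this uniformity later allows passing
to the limit in `ν` under an integral. -/
lemma gaussMellin_bounded {s₀ : ℂ} (hs : 0 < s₀.re) (c : ℝ) :
    ∃ C : ℝ, ∀ᶠ s in nhds s₀, ∀ x, c ≤ x → ‖gaussMellin s x‖ ≤ C := by
  set σ := s₀.re
  have i1 := integrableOn_rpow_mul_gaussKernel (σ := σ / 2) (by positivity) c
  have i2 := integrableOn_rpow_mul_gaussKernel (σ := σ + 1) (by positivity) c
  refine ⟨∫ t in Set.Ioi (0 : ℝ), (t ^ (σ / 2 - 1) * gaussKernel c t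
    + t ^ (σ + 1 - 1) * gaussKernel c t), ?_⟩
  have e1 : ∀ᶠ s in nhds s₀, σ / 2 < s.re :=
    Complex.continuous_re.continuousAt.eventually_const_lt (by change σ / 2 < σ; linarith)
  have e2 : ∀ᶠ s in nhds s₀, s.re < σ + 1 :=
    Complex.continuous_re.continuousAt.eventually_lt_const (by change σ < σ + 1; linarith)
  filter_upwards [e1, e2] with s h1 h2 x hx
  refine norm_integral_le_of_norm_le (i1.add i2) ?_
  filter_upwards [ae_restrict_mem measurableSet_Ioi] with t ht
  have ht : (0 : ℝ) < t := ht
  rw [norm_mellinIntegrand_gaussKernel _ _ ht]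
  have hk := gaussKernel_anti hx ht.le
  have hp := gaussKernel_pos c t
  have a1 : 0 ≤ t ^ (σ / 2 - 1) := Real.rpow_nonneg ht.le _
  have a2 : 0 ≤ t ^ (σ + 1 - 1) := Real.rpow_nonneg ht.le _
  -- The first power dominates for `t ≤ 1`, the second for `t ≥ 1`.
  have : t ^ (s.re - 1) ≤ t ^ (σ / 2 - 1) + t ^ (σ + 1 - 1) := by
    rcases le_total t 1 with h | h
    · have := Real.rpow_le_rpow_of_exponent_ge ht h (show σ / 2 - 1 ≤ s.re - 1 by linarith)
      linarith
    · have := Real.rpow_le_rpow_of_exponent_le h (show s.re - 1 ≤ σ + 1 - 1 by linarith)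
      linarith
  calc _ ≤ (t ^ (σ / 2 - 1) + t ^ (σ + 1 - 1)) * gaussKernel c t :=
        mul_le_mul this hk (gaussKernel_pos x t).le (by positivity)
    _ = _ := by ring

/-! ### Continuation in `s` of the decaying solutions, and their Hermite values. -/

/-- The solutions `U(s, x)` of `U'' - x U' = s U` of moderate growth at `+∞`, normalised by
`U(s, x) = Γ(s)⁻¹ ∫_0^∞ t^{s-1} e^{-xt - t²/2} dt` for `Re s > 0` and continued by `k` steps of the
three-term recurrence to `Re s > -k`. -/
noncomputable def weberU : ℕ → ℂ → ℝ → ℂ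
  | 0, s, x => gaussMellin s x * (Complex.Gamma s)⁻¹
  | k + 1, s, x => (s + 1) * weberU k (s + 2) x + x * weberU k (s + 1) x

lemma weberU_succ (k : ℕ) (s : ℂ) (x : ℝ) :
    weberU (k + 1) s x = (s + 1) * weberU k (s + 2) x + x * weberU k (s + 1) x := rfl

lemma weberU_recurrence (k : ℕ) : ∀ {s : ℂ}, -(k : ℝ) < s.re → ∀ x : ℝ,
    weberU k s x = (s + 1) * weberU k (s + 2) x + x * weberU k (s + 1) x := by
  induction k with
  | zero =>
    intro s hs x
    have hs : 0 < s.re := by simpa using hs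
    have hs0 : s ≠ 0 := by rintro rfl; simp at hs
    have hs1 : s + 1 ≠ 0 := by
      intro h
      have := congrArg Complex.re h
      simp at this; linarith
    have hG : Complex.Gamma s ≠ 0 := Complex.Gamma_ne_zero_of_re_pos hs
    simp only [weberU]
    rw [show s + 2 = s + 1 + 1 by ring, Complex.Gamma_add_one _ hs1, Complex.Gamma_add_one _ hs0]
    have := gaussMellin_recurrence hs x
    rw [show s + 2 = s + 1 + 1 by ring] at this
    field_simp
    linear_combination -this
  | succ k ih =>
    intro s hs x
    push_cast at hs
    have h1 : -(k : ℝ) < (s + 1).re := by simp; linarith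
    have h2 : -(k : ℝ) < (s + 2).re := by simp; linarith
    conv_rhs => rw [weberU_succ, weberU_succ, ← ih h1, ← ih h2]
    exact weberU_succ k s x

/-- Consistency of the continuation: one more step changes nothing where the previous one is already
valid. -/
lemma weberU_succ_eq {k : ℕ} {s : ℂ} (hs : -(k : ℝ) < s.re) (x : ℝ) :
    weberU (k + 1) s x = weberU k s x := by
  rw [weberU_recurrence k hs, weberU_succ]

lemma hasDerivAt_weberU (k : ℕ) : ∀ {s : ℂ}, -(k : ℝ) < s.re → ∀ x : ℝ,
    HasDerivAt (weberU k s) (-s * weberU k (s + 1) x) x := by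
  induction k with
  | zero =>
    intro s hs x
    have hs : 0 < s.re := by simpa using hs
    have hs0 : s ≠ 0 := by rintro rfl; simp at hs
    have hG : Complex.Gamma s ≠ 0 := Complex.Gamma_ne_zero_of_re_pos hs
    refine ((hasDerivAt_gaussMellin hs x).mul_const (Complex.Gamma s)⁻¹).congr_deriv ?_
    simp only [weberU]
    rw [Complex.Gamma_add_one _ hs0]
    field_simp
  | succ k ih =>
    intro s hs x
    push_cast at hs
    have h1 : -(k : ℝ) < (s + 1).re := by simp; linarith
    have h2 : -(k : ℝ) < (s + 2).re := by simp; linarith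
    have d := ((ih h2 x).const_mul (s + 1)).add
      (((hasDerivAt_id x).ofReal_comp).mul (ih h1 x))
    refine d.congr_deriv ?_
    have r := weberU_recurrence k h1 x
    rw [weberU_succ_eq h1]
    rw [show s + 1 + 2 = s + 2 + 1 by ring, show s + 1 + 1 = s + 2 by ring] at r
    rw [show s + 1 + 1 = s + 2 by ring]
    simp only [id, Complex.ofReal_one]
    linear_combination (s + 1) * r

lemma differentiableAt_weberU_left (k : ℕ) : ∀ {s : ℂ}, -(k : ℝ) < s.re → ∀ x : ℝ,
    DifferentiableAt ℂ (fun s => weberU k s x) s := by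
  induction k with
  | zero =>
    intro s hs x
    have hs : 0 < s.re := by simpa using hs
    exact (differentiableAt_gaussMellin hs x).mul (Complex.differentiable_one_div_Gamma s)
  | succ k ih =>
    intro s hs x
    push_cast at hs
    have h1 : -(k : ℝ) < (s + 1).re := by simp; linarith
    have h2 : -(k : ℝ) < (s + 2).re := by simp; linarith
    have d1 : DifferentiableAt ℂ (fun s => weberU k (s + 1) x) s :=
      (ih h1 x).comp s (f := fun s => s + 1) (by fun_prop)
    have d2 : DifferentiableAt ℂ (fun s => weberU k (s + 2) x) s :=
      (ih h2 x).comp s (f := fun s => s + 2) (by fun_prop)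
    simp only [weberU_succ]
    fun_prop

lemma weberU_bound (k : ℕ) (c : ℝ) : ∀ {s₀ : ℂ}, -(k : ℝ) < s₀.re →
    ∃ C : ℝ, 0 ≤ C ∧ ∀ᶠ s in nhds s₀, ∀ x, c ≤ x → ‖weberU k s x‖ ≤ C * (1 + |x|) ^ k := by
  induction k with
  | zero =>
    intro s₀ hs
    have hs : 0 < s₀.re := by simpa using hs
    obtain ⟨C, hC⟩ := gaussMellin_bounded hs c
    set D := ‖(Complex.Gamma s₀)⁻¹‖ + 1
    have hD : ∀ᶠ s in nhds s₀, ‖(Complex.Gamma s)⁻¹‖ < D :=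
      (Complex.differentiable_one_div_Gamma.continuous.norm.continuousAt).eventually_lt_const
        (lt_add_one _)
    refine ⟨|C| * D, by positivity, ?_⟩
    filter_upwards [hC, hD] with s h1 h2 x hx
    simp only [weberU, pow_zero, mul_one, norm_mul]
    exact mul_le_mul ((h1 x hx).trans (le_abs_self C)) h2.le (norm_nonneg _) (abs_nonneg _)
  | succ k ih =>
    intro s₀ hs
    push_cast at hs
    have h1 : -(k : ℝ) < (s₀ + 1).re := by simp; linarith
    have h2 : -(k : ℝ) < (s₀ + 2).re := by simp; linarith
    obtain ⟨C₁, p₁, e₁⟩ := ih h1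
    obtain ⟨C₂, p₂, e₂⟩ := ih h2
    have t1 := (show Continuous fun s : ℂ => s + 1 by fun_prop).continuousAt.eventually e₁
    have t2 := (show Continuous fun s : ℂ => s + 2 by fun_prop).continuousAt.eventually e₂
    set D := ‖s₀ + 1‖ + 1
    have hD : ∀ᶠ s in nhds s₀, ‖s + 1‖ < D :=
      ((show Continuous fun s : ℂ => s + 1 by fun_prop).norm.continuousAt).eventually_lt_const
        (lt_add_one _)
    refine ⟨D * C₂ + C₁, by positivity, ?_⟩
    filter_upwards [t1, t2, hD] with s a1 a2 a3 x hx
    rw [weberU_succ]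
    have b1 := a1 x hx
    have b2 := a2 x hx
    have hx0 := abs_nonneg x
    calc _ ≤ ‖s + 1‖ * ‖weberU k (s + 2) x‖ + |x| * ‖weberU k (s + 1) x‖ := by
          refine (norm_add_le _ _).trans ?_
          rw [norm_mul, norm_mul, Complex.norm_real, Real.norm_eq_abs]
      _ ≤ D * (C₂ * (1 + |x|) ^ k) + |x| * (C₁ * (1 + |x|) ^ k) := by gcongr
      _ ≤ (D * (C₂ * (1 + |x|) ^ k)) * (1 + |x|) + (1 + |x|) * (C₁ * (1 + |x|) ^ k) := by
          refine add_le_add (le_mul_of_one_le_right (by positivity) (by linarith)) ?_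
          gcongr; linarith
      _ = _ := by ring

/-- After one recurrence step at `s = 0` the integrand is the total derivative of `-e^{-xt - t²/2}`,
which integrates to `1`. -/
lemma weberU_zero {k : ℕ} (hk : 0 < k) (x : ℝ) : weberU k 0 x = 1 := by
  induction k, hk using Nat.le_induction with
  | base =>
    have h := MeasureTheory.integral_Ioi_of_hasDerivAt_of_tendsto (a := 0) (m := (0 : ℂ))
      (f := fun t : ℝ => -(gaussKernel x t : ℂ))
      (f' := fun t => (t : ℂ) ^ ((2 : ℂ) - 1) • (gaussKernel x t : ℂ)
        + x * ((t : ℂ) ^ ((1 : ℂ) - 1) • (gaussKernel x t : ℂ)))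
      (Complex.continuous_ofReal.comp (continuous_gaussKernel x)).neg.continuousWithinAt
      (fun t _ => by
        refine (hasDerivAt_gaussKernel x t).ofReal_comp.neg.congr_deriv ?_
        rw [show (2 : ℂ) - 1 = 1 by norm_num, sub_self]
        simp; ring)
      ((mellinConvergent_gaussKernel (by simp) x).add
        ((mellinConvergent_gaussKernel (by simp) x).const_mul (x : ℂ))) ?_
    · rw [integral_add (mellinConvergent_gaussKernel (by simp) x)
        ((mellinConvergent_gaussKernel (by simp) x).const_mul (x : ℂ)), integral_const_mul] at h
      change gaussMellin 2 x + x * gaussMellin 1 x = _ at h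
      simp only [weberU, zero_add, one_mul]
      rw [show (2 : ℂ) = 1 + 1 by norm_num, Complex.Gamma_add_one 1 one_ne_zero, Complex.Gamma_one]
      simp only [mul_one, inv_one]
      rw [show (1 : ℂ) + 1 = 2 by norm_num, h]
      simp [gaussKernel]
    · rw [tendsto_zero_iff_norm_tendsto_zero]
      have hlim := (tendsto_rpow_mul_exp_neg_mul_atTop_nhds_zero 0 1 one_pos).const_mul
        (Real.exp ((1 - x) ^ 2 / 2))
      rw [mul_zero] at hlim
      refine squeeze_zero (fun t => norm_nonneg _) (fun t => ?_) hlim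
      rw [norm_neg, Complex.norm_real, Real.norm_of_nonneg (gaussKernel_pos x t).le, Real.rpow_zero,
        one_mul]
      exact gaussKernel_le x t
  | succ k hk ih =>
    have hk' : (0 : ℝ) < k := by exact_mod_cast hk
    rw [weberU_succ_eq (by simpa using hk'), ih]

/-- The recurrence at `s = -(n+1)`, combined with `U' = n U(-n+1, ·)` at `s = -n`, is `He_{n+1} = x
He_n - He_n'`. -/
lemma weberU_neg_nat {n k : ℕ} (hk : n < k) (x : ℝ) :
    weberU k (-(n : ℂ)) x = ((Polynomial.aeval x (Polynomial.hermite n) : ℝ) : ℂ) := by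
  induction n generalizing x with
  | zero => simpa using weberU_zero hk x
  | succ n ih =>
    have hk' : ((n : ℝ) + 1) < k := by exact_mod_cast hk
    have ih := fun x => ih (by omega) x
    have h1 := weberU_recurrence k (s := -((n + 1 : ℕ) : ℂ)) (by simpa using hk') x
    have h2 : HasDerivAt (weberU k (-(n : ℂ))) _ x :=
      hasDerivAt_weberU k (by simp; linarith) x
    have h3 : HasDerivAt (weberU k (-(n : ℂ)))
        ((Polynomial.aeval x (Polynomial.derivative (Polynomial.hermite n)) : ℝ) : ℂ) x := by
      rw [funext ih]
      exact ((Polynomial.hermite n).hasDerivAt_aeval x).ofReal_comp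
    have h4 := h2.unique h3
    rw [h1, Polynomial.hermite_succ]
    push_cast at h4 ⊢
    simp only [map_sub, map_mul, Polynomial.aeval_X, Complex.ofReal_sub, Complex.ofReal_mul]
    rw [← h4, ← ih x]
    rw [show -((n : ℂ) + 1) + 2 = -n + 1 by ring, show -((n : ℂ) + 1) + 1 = -n by ring]
    ring

/-! ### Calculus for weak derivatives. -/

lemma Real.deriv_smoothTransition_eq_zero {u : ℝ} (hu : u ∉ Set.Ioc (0 : ℝ) 1) :
    deriv Real.smoothTransition u = 0 := by
  rw [Set.mem_Ioc, not_and_or, not_lt, not_le] at hu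
  rcases hu with hu | hu
  · refine IsLocalMin.deriv_eq_zero (Filter.Eventually.of_forall fun y => ?_)
    rw [Real.smoothTransition.zero_of_nonpos hu]
    exact Real.smoothTransition.nonneg y
  · refine IsLocalMax.deriv_eq_zero (Filter.Eventually.of_forall fun y => ?_)
    rw [Real.smoothTransition.one_of_one_le hu.le]
    exact Real.smoothTransition.le_one y

lemma Real.hasDerivAt_smoothTransition (u : ℝ) :
    HasDerivAt Real.smoothTransition (deriv Real.smoothTransition u) u :=
  ((Real.smoothTransition.contDiff (n := 1)).differentiable (by norm_num) u).hasDerivAt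

lemma Real.continuous_deriv_smoothTransition : Continuous (deriv Real.smoothTransition) :=
  (Real.smoothTransition.contDiff (n := 1)).continuous_deriv (by norm_num)

lemma integral_smoothTransition_scaled {g : ℝ → ℂ} (c : ℝ) {ε : ℝ} (hε : 0 < ε) :
    ∫ x, (deriv Real.smoothTransition ((x - c) / ε) / ε) • g x
      = ∫ u in (0 : ℝ)..1, deriv Real.smoothTransition u • g (c + ε * u) := by
  rw [intervalIntegral.integral_eq_integral_of_support_subset]
  · have h1 := integral_add_left_eq_self (μ := volume)
      (fun x => (deriv Real.smoothTransition ((x - c) / ε) / ε) • g x) c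
    have h2 := Measure.integral_comp_mul_left
      (fun x => (deriv Real.smoothTransition ((c + x - c) / ε) / ε) • g (c + x)) ε
    rw [h1] at h2
    rw [abs_of_pos (inv_pos.2 hε)] at h2
    have h3 : ∫ x, (deriv Real.smoothTransition ((x - c) / ε) / ε) • g x
        = ε • ∫ x, (deriv Real.smoothTransition ((c + ε * x - c) / ε) / ε) • g (c + ε * x) := by
      rw [h2, smul_smul, mul_inv_cancel₀ hε.ne', one_smul]
    rw [h3, ← integral_smul]
    refine integral_congr_ae (Filter.Eventually.of_forall fun x => ?_)
    simp only [add_sub_cancel_left]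
    rw [mul_div_cancel_left₀ _ hε.ne', smul_smul, mul_div_cancel₀ _ hε.ne']
  · intro u hu
    by_contra hn
    exact hu (by simp [Real.deriv_smoothTransition_eq_zero hn])

/-- The rescaled derivative of the smooth step has integral `1` and support shrinking to `c`, so it
is an approximate identity. -/
lemma tendsto_integral_smoothTransition_scaled {g : ℝ → ℂ} (hg : Continuous g) (c : ℝ) :
    Filter.Tendsto (fun ε => ∫ x, (deriv Real.smoothTransition ((x - c) / ε) / ε) • g x)
      (nhdsWithin 0 (Set.Ioi 0)) (nhds (g c)) := by
  have hc : Continuous fun ε : ℝ =>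
      ∫ u in (0 : ℝ)..1, deriv Real.smoothTransition u • g (c + ε * u) := by
    refine intervalIntegral.continuous_parametric_intervalIntegral_of_continuous' ?_ 0 1
    exact (Real.continuous_deriv_smoothTransition.comp continuous_snd).smul
      (hg.comp (by fun_prop))
  have h0 : ∫ u in (0 : ℝ)..1, deriv Real.smoothTransition u • g (c + 0 * u) = g c := by
    simp only [zero_mul, add_zero]
    rw [intervalIntegral.integral_smul_const,
      intervalIntegral.integral_deriv_eq_sub (fun x _ => (Real.hasDerivAt_smoothTransition x).differentiableAt)
        (Real.continuous_deriv_smoothTransition.intervalIntegrable _ _)]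
    simp
  have := (hc.tendsto 0).mono_left (nhdsWithin_le_nhds (s := Set.Ioi 0))
  rw [h0] at this
  refine this.congr' ?_
  filter_upwards [self_mem_nhdsWithin] with ε hε
  exact (integral_smoothTransition_scaled c hε).symm

/-- The fundamental theorem of calculus for weak derivatives. -/
lemma HasWeakDerivative.integral_eq_sub {g g' : ℝ → ℂ} (h : HasWeakDerivative g g')
    (hg : Continuous g) (hg' : LocallyIntegrable g') {a b : ℝ} (hab : a ≤ b) :
    ∫ x in a..b, g' x = g b - g a := by
  set S := Real.smoothTransition
  -- A smoothed indicator of `(a, b]`: as `ε → 0+` its derivative tends to `δ_a - δ_b`.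
  set φ : ℝ → ℝ → ℝ := fun ε x => S ((x - a) / ε) - S ((x - b) / ε)
  have hsupp : ∀ {ε x : ℝ}, 0 < ε → x ∉ Set.Icc a (b + ε) → φ ε x = 0 := by
    intro ε x hε hx
    rw [Set.mem_Icc, not_and_or, not_le, not_le] at hx
    rcases hx with hx | hx
    · have h1 : (x - a) / ε ≤ 0 := div_nonpos_of_nonpos_of_nonneg (by linarith) hε.le
      have h2 : (x - b) / ε ≤ 0 := div_nonpos_of_nonpos_of_nonneg (by linarith) hε.le
      simp [φ, S, Real.smoothTransition.zero_of_nonpos h1, Real.smoothTransition.zero_of_nonpos h2]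
    · have h1 : 1 ≤ (x - a) / ε := by rw [le_div_iff₀ hε]; linarith
      have h2 : 1 ≤ (x - b) / ε := by rw [le_div_iff₀ hε]; linarith
      simp [φ, S, Real.smoothTransition.one_of_one_le h1, Real.smoothTransition.one_of_one_le h2]
  have hsmooth : ∀ ε, ContDiff ℝ ∞ (φ ε) := fun ε => by
    have hS : ContDiff ℝ ∞ S := Real.smoothTransition.contDiff
    exact (hS.comp (by fun_prop)).sub (hS.comp (by fun_prop))
  have hderiv : ∀ {ε} (x), deriv (φ ε) x = deriv S ((x - a) / ε) / ε - deriv S ((x - b) / ε) / ε := by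
    intro ε x
    have d : ∀ c : ℝ, HasDerivAt (fun x => S ((x - c) / ε)) (deriv S ((x - c) / ε) / ε) x := by
      intro c
      have := (Real.hasDerivAt_smoothTransition ((x - c) / ε)).comp x
        (((hasDerivAt_id x).sub_const c).div_const ε)
      refine this.congr_deriv ?_
      rw [mul_one_div]
    exact ((d a).sub (d b)).deriv
  have hcomp : ∀ {ε}, 0 < ε → HasCompactSupport (φ ε) := fun hε =>
    HasCompactSupport.intro isCompact_Icc fun x hx => hsupp hε hx
  have hint : ∀ {ε : ℝ} (c : ℝ), 0 < ε → Integrable fun x => (deriv S ((x - c) / ε) / ε) • g x := by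
    intro ε c hε
    refine Continuous.integrable_of_hasCompactSupport ?_ ?_
    · exact ((Real.continuous_deriv_smoothTransition.comp (by fun_prop)).div_const ε).smul hg
    · refine HasCompactSupport.intro (isCompact_Icc (a := c) (b := c + ε)) fun x hx => ?_
      have : (x - c) / ε ∉ Set.Ioc (0 : ℝ) 1 := by
        rintro ⟨h1, h2⟩
        rw [div_le_one hε] at h2
        have h1 := (div_pos_iff_of_pos_right hε).1 h1
        exact hx ⟨by linarith, by linarith⟩
      simp [S, Real.deriv_smoothTransition_eq_zero this]
  have lim1 : Filter.Tendsto (fun ε => ∫ x, deriv (φ ε) x • g x)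
      (nhdsWithin 0 (Set.Ioi 0)) (nhds (g a - g b)) := by
    refine ((tendsto_integral_smoothTransition_scaled hg a).sub
      (tendsto_integral_smoothTransition_scaled hg b)).congr' ?_
    filter_upwards [self_mem_nhdsWithin] with ε hε
    rw [← integral_sub (hint a hε) (hint b hε)]
    refine integral_congr_ae (Filter.Eventually.of_forall fun x => ?_)
    simp only [hderiv, sub_smul, S]
  have lim2 : Filter.Tendsto (fun ε => ∫ x, φ ε x • g' x)
      (nhdsWithin 0 (Set.Ioi 0)) (nhds (∫ x, (Set.Ioc a b).indicator g' x)) := by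
    refine tendsto_integral_filter_of_dominated_convergence
      ((Set.Icc a (b + 1)).indicator fun x => ‖g' x‖) ?_ ?_ ?_ ?_
    · exact Filter.Eventually.of_forall fun ε =>
        (hsmooth ε).continuous.aestronglyMeasurable.smul hg'.aestronglyMeasurable
    · filter_upwards [self_mem_nhdsWithin, nhdsWithin_le_nhds (Iio_mem_nhds one_pos)] with ε hε h1
      refine Filter.Eventually.of_forall fun x => ?_
      have hε : 0 < ε := hε
      have h1 : ε < 1 := h1
      by_cases hx : x ∈ Set.Icc a (b + 1)
      · rw [Set.indicator_of_mem hx, norm_smul]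
        refine mul_le_of_le_one_left (norm_nonneg _) ?_
        rw [Real.norm_eq_abs, abs_le]
        have n1 := Real.smoothTransition.nonneg ((x - a) / ε)
        have n2 := Real.smoothTransition.nonneg ((x - b) / ε)
        have n3 := Real.smoothTransition.le_one ((x - a) / ε)
        have n4 := Real.smoothTransition.le_one ((x - b) / ε)
        constructor <;> simp only [φ, S] <;> linarith
      · rw [Set.indicator_of_notMem hx, hsupp hε (fun h => hx ⟨h.1, by linarith [h.2]⟩)]
        simp
    · exact (integrable_indicator_iff measurableSet_Icc).2
        (hg'.integrableOn_isCompact isCompact_Icc).norm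
    · refine Filter.Eventually.of_forall fun x => ?_
      have key : ∀ c : ℝ, Filter.Tendsto (fun ε => S ((x - c) / ε)) (nhdsWithin 0 (Set.Ioi 0))
          (nhds (if c < x then 1 else 0)) := by
        intro c
        refine tendsto_const_nhds.congr' ?_
        by_cases hc : c < x
        · filter_upwards [self_mem_nhdsWithin,
            nhdsWithin_le_nhds (Iio_mem_nhds (sub_pos.2 hc))] with ε hε h1
          rw [if_pos hc]
          refine (Real.smoothTransition.one_of_one_le ?_).symm
          rw [le_div_iff₀ hε, one_mul]
          exact le_of_lt h1
        · filter_upwards [self_mem_nhdsWithin] with ε hε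
          rw [if_neg hc]
          exact (Real.smoothTransition.zero_of_nonpos
            (div_nonpos_of_nonpos_of_nonneg (by linarith) (le_of_lt hε))).symm
      have := ((key a).sub (key b)).smul_const (g' x)
      convert this using 2
      by_cases h1 : a < x <;> by_cases h2 : b < x
      · simp [h1, h2]
      · simp [h1, h2, not_lt.1 h2]
      · exact absurd (hab.trans_lt h2) h1
      · simp [h1, h2]
  have heq : ∫ x, (Set.Ioc a b).indicator g' x = -(g a - g b) := by
    refine tendsto_nhds_unique lim2 (lim1.neg.congr' ?_)
    filter_upwards [self_mem_nhdsWithin] with ε hε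
    rw [h (φ ε) (hsmooth ε) (hcomp hε), neg_neg]
  rw [integral_indicator measurableSet_Ioc] at heq
  rw [intervalIntegral.integral_of_le hab, heq]
  ring

lemma HasWeakDerivative.smooth_mul {g g' K K' : ℝ → ℂ} (h : HasWeakDerivative g g')
    (hg : LocallyIntegrable g) (hg' : LocallyIntegrable g') (hK : ContDiff ℝ ∞ K)
    (hK' : ∀ x, HasDerivAt K (K' x) x) :
    HasWeakDerivative (fun x => K x * g x) (fun x => K x * g' x + K' x * g x) := by
  intro φ hφ hc
  have hre : ContDiff ℝ ∞ fun x => (K x).re := Complex.reCLM.contDiff.comp hK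
  have him : ContDiff ℝ ∞ fun x => (K x).im := Complex.imCLM.contDiff.comp hK
  have dre : ∀ x, HasDerivAt (fun x => (K x).re) (K' x).re x := fun x =>
    Complex.reCLM.hasFDerivAt.comp_hasDerivAt x (hK' x)
  have dim : ∀ x, HasDerivAt (fun x => (K x).im) (K' x).im x := fun x =>
    Complex.imCLM.hasFDerivAt.comp_hasDerivAt x (hK' x)
  have dφ : ∀ x, HasDerivAt φ (deriv φ x) x := fun x =>
    (hφ.differentiable (by simp) x).hasDerivAt
  have hcφ' : Continuous (deriv φ) := hφ.continuous_deriv (by simp)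
  have hK'c : Continuous K' := by
    rw [show K' = deriv K from funext fun x => (hK' x).deriv.symm]
    exact hK.continuous_deriv (by simp)
  -- Test functions are real-valued, so the complex factor `K` is absorbed through its real and
  -- imaginary parts separately.
  have e1 := h (fun x => φ x * (K x).re) (hφ.mul hre) hc.mul_right
  have e2 := h (fun x => φ x * (K x).im) (hφ.mul him) hc.mul_right
  simp only [fun x => ((dφ x).fun_mul (dre x)).deriv, fun x => ((dφ x).fun_mul (dim x)).deriv] at e1 e2
  have I : ∀ (ψ : ℝ → ℝ) (u : ℝ → ℂ), Continuous ψ → HasCompactSupport ψ → LocallyIntegrable u →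
      Integrable (fun x => ψ x • u x) := fun ψ u h1 h2 h3 =>
    h3.integrable_smul_left_of_hasCompactSupport h1 h2
  have hcre := hre.continuous
  have hcim := him.continuous
  have hcre' : Continuous fun x => (K' x).re := Complex.continuous_re.comp hK'c
  have hcim' : Continuous fun x => (K' x).im := Complex.continuous_im.comp hK'c
  have i1 := I (fun x => deriv φ x * (K x).re + φ x * (K' x).re) g
    ((hcφ'.mul hcre).add (hφ.continuous.mul hcre')) (hc.deriv.mul_right.add hc.mul_right) hg
  have i2 := I (fun x => deriv φ x * (K x).im + φ x * (K' x).im) g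
    ((hcφ'.mul hcim).add (hφ.continuous.mul hcim')) (hc.deriv.mul_right.add hc.mul_right) hg
  have i3 := I (fun x => φ x * (K x).re) g' (hφ.continuous.mul hcre) hc.mul_right hg'
  have i4 := I (fun x => φ x * (K x).im) g' (hφ.continuous.mul hcim) hc.mul_right hg'
  have i5 := I (fun x => φ x * (K' x).re) g (hφ.continuous.mul hcre') hc.mul_right hg
  have i6 := I (fun x => φ x * (K' x).im) g (hφ.continuous.mul hcim') hc.mul_right hg
  have C : ∀ u v : ℝ → ℂ, Integrable u → Integrable v →
      Integrable (fun x => u x + Complex.I * v x) := fun u v hu hv => hu.add (hv.const_mul _)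
  have i12 := C _ _ i1 i2
  have i34 := C _ _ i3 i4
  have i56 := C _ _ i5 i6
  beta_reduce at i12 i34 i56
  have E : ∀ z : ℂ, z = z.re + z.im * Complex.I := fun z => (Complex.re_add_im z).symm
  have l1 : ∫ x, deriv φ x • (K x * g x)
      = ((∫ x, (deriv φ x * (K x).re + φ x * (K' x).re) • g x)
        + Complex.I * ∫ x, (deriv φ x * (K x).im + φ x * (K' x).im) • g x)
        - ((∫ x, (φ x * (K' x).re) • g x) + Complex.I * ∫ x, (φ x * (K' x).im) • g x) := by
    rw [← integral_const_mul, ← integral_const_mul, ← integral_add i1 (i2.const_mul _),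
      ← integral_add i5 (i6.const_mul _),
      ← integral_sub i12 i56]
    refine integral_congr_ae (Filter.Eventually.of_forall fun x => ?_)
    simp only [Complex.real_smul]
    conv_lhs => rw [E (K x)]
    push_cast; ring
  have l2 : ∫ x, φ x • (K x * g' x + K' x * g x)
      = ((∫ x, (φ x * (K x).re) • g' x) + Complex.I * ∫ x, (φ x * (K x).im) • g' x)
        + ((∫ x, (φ x * (K' x).re) • g x) + Complex.I * ∫ x, (φ x * (K' x).im) • g x) := by
    rw [← integral_const_mul, ← integral_const_mul, ← integral_add i3 (i4.const_mul _),
      ← integral_add i5 (i6.const_mul _),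
      ← integral_add i34 i56]
    refine integral_congr_ae (Filter.Eventually.of_forall fun x => ?_)
    simp only [Complex.real_smul]
    conv_lhs => rw [E (K x), E (K' x)]
    push_cast; ring
  rw [l1, l2, e1, e2]
  ring

lemma HasWeakDerivative.conj {g g' : ℝ → ℂ} (h : HasWeakDerivative g g') :
    HasWeakDerivative (fun x => conj (g x)) (fun x => conj (g' x)) := by
  intro φ hφ hc
  have := congrArg conj (h φ hφ hc)
  rw [map_neg, ← integral_conj, ← integral_conj] at this
  simpa using this

section HalfLine

variable {g g' : ℝ → ℂ}

/-- Integrability of `g'` gives `g` a limit at infinity, and integrability of `g` forces that limit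
to be `0`. Hence no boundary term at infinity appears. -/
lemma HasWeakDerivative.integral_Ioi (h : HasWeakDerivative g g') (hg : Continuous g)
    (hg' : LocallyIntegrable g') {s : ℝ} (hi : IntegrableOn g (Set.Ioi s))
    (hi' : IntegrableOn g' (Set.Ioi s)) : ∫ x in Set.Ioi s, g' x = -g s := by
  have lim := intervalIntegral_tendsto_integral_Ioi s hi' Filter.tendsto_id
  have lim2 : Filter.Tendsto g Filter.atTop (nhds ((∫ x in Set.Ioi s, g' x) + g s)) := by
    refine (lim.add_const (g s)).congr' ?_
    filter_upwards [Filter.eventually_ge_atTop s] with R hR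
    rw [id, h.integral_eq_sub hg hg' hR]; ring
  have := IntegrableAtFilter.eq_zero_of_tendsto (μ := volume)
    ⟨Set.Ioi s, Filter.Ioi_mem_atTop s, hi⟩ (fun t ht => by
      obtain ⟨b, hb⟩ := Filter.mem_atTop_sets.1 ht
      exact top_unique (Real.volume_Ici (a := b) ▸ measure_mono hb)) lim2
  linear_combination this

lemma HasWeakDerivative.integral_Iic (h : HasWeakDerivative g g') (hg : Continuous g)
    (hg' : LocallyIntegrable g') {s : ℝ} (hi : IntegrableOn g (Set.Iic s))
    (hi' : IntegrableOn g' (Set.Iic s)) : ∫ x in Set.Iic s, g' x = g s := by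
  have lim := intervalIntegral_tendsto_integral_Iic s hi' Filter.tendsto_id
  have lim2 : Filter.Tendsto g Filter.atBot (nhds (g s - ∫ x in Set.Iic s, g' x)) := by
    refine (lim.const_sub (g s)).congr' ?_
    filter_upwards [Filter.eventually_le_atBot s] with R hR
    rw [id, h.integral_eq_sub hg hg' hR]; ring
  have := IntegrableAtFilter.eq_zero_of_tendsto (μ := volume)
    ⟨Set.Iic s, Filter.Iic_mem_atBot s, hi⟩ (fun t ht => by
      obtain ⟨b, hb⟩ := Filter.mem_atBot_sets.1 ht
      exact top_unique (Real.volume_Iic (a := b) ▸ measure_mono hb)) lim2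
  linear_combination -this

end HalfLine

/-! ### Weber solutions paired with the form on half-lines. -/

/-- `y`, with derivative `y'`, is a smooth solution of `-y'' + (x²/4 - 1/2) y = ν y` on the line
such that `y`, `y'` and `x y` are square integrable on `T`. -/
structure IsWeberSolution (ν : ℂ) (y y' : ℝ → ℂ) (T : Set ℝ) : Prop where
  contDiff : ContDiff ℝ ∞ y
  contDiff' : ContDiff ℝ ∞ y'
  hasDerivAt : ∀ x, HasDerivAt y (y' x) x
  hasDerivAt' : ∀ x : ℝ, HasDerivAt y' (((x : ℂ) ^ 2 / 4 - 1 / 2 - ν) * y x) x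
  memLp : MemLp y 2 (volume.restrict T)
  memLp' : MemLp y' 2 (volume.restrict T)
  memLp_mul : MemLp (fun x : ℝ => (x : ℂ) * y x) 2 (volume.restrict T)

namespace IsWeberSolution

variable {ν : ℂ} {y y' : ℝ → ℂ} {T : Set ℝ}

lemma const_mul (h : IsWeberSolution ν y y' T) (c : ℂ) :
    IsWeberSolution ν (fun x => c * y x) (fun x => c * y' x) T where
  contDiff := contDiff_const.mul h.contDiff
  contDiff' := contDiff_const.mul h.contDiff'
  hasDerivAt x := (h.hasDerivAt x).const_mul c
  hasDerivAt' x := ((h.hasDerivAt' x).const_mul c).congr_deriv (by ring)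
  memLp := h.memLp.const_mul c
  memLp' := h.memLp'.const_mul c
  memLp_mul := (h.memLp_mul.const_mul c).ae_eq
    (Filter.Eventually.of_forall fun x => by ring)

lemma comp_neg {s : ℝ} (h : IsWeberSolution ν y y' (Set.Ioi (-s))) :
    IsWeberSolution ν (fun x => y (-x)) (fun x => -y' (-x)) (Set.Iic s) := by
  have hmp : MeasurePreserving (fun x : ℝ => -x) (volume.restrict (Set.Iio s))
      (volume.restrict (Set.Ioi (-s))) := by
    have := (Measure.measurePreserving_neg (volume : Measure ℝ)).restrict_preimage
      (measurableSet_Ioi (a := -s))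
    have e : (Neg.neg ⁻¹' Set.Ioi (-s) : Set ℝ) = Set.Iio s := by ext; simp
    rwa [e] at this
  have hr : volume.restrict (Set.Iic s) = volume.restrict (Set.Iio s) :=
    (Measure.restrict_congr_set Iio_ae_eq_Iic).symm
  refine ⟨h.contDiff.comp contDiff_neg, (h.contDiff'.comp contDiff_neg).neg, fun x => ?_,
    fun x => ?_, ?_, ?_, ?_⟩
  · exact ((h.hasDerivAt (-x)).scomp x (hasDerivAt_neg x)).congr_deriv (by simp)
  · have := ((h.hasDerivAt' (-x)).scomp x (hasDerivAt_neg x)).neg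
    refine this.congr_deriv ?_
    simp
  · rw [hr]; exact h.memLp.comp_measurePreserving hmp
  · rw [hr]; exact (h.memLp'.comp_measurePreserving hmp).neg
  · rw [hr]
    refine ((h.memLp_mul.comp_measurePreserving hmp).neg).ae_eq
      (Filter.Eventually.of_forall fun x => ?_)
    simp

lemma integrable_pairings (h : IsWeberSolution ν y y' T) (g : PCFormDomain) :
    IntegrableOn (fun x => y x * conj (g.toFun x)) T ∧
    IntegrableOn (fun x => y' x * conj (g.toFun x)) T ∧
    IntegrableOn (fun x => y' x * conj (g.wderiv x)) T ∧
    IntegrableOn (fun x : ℝ => ((x : ℂ) * y x) * conj ((x : ℂ) * g.toFun x)) T :=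
  ⟨h.memLp.integrable_mul (g.memLp_toFun.restrict T).star,
    h.memLp'.integrable_mul (g.memLp_toFun.restrict T).star,
    h.memLp'.integrable_mul (g.memLp_wderiv.restrict T).star,
    h.memLp_mul.integrable_mul (g.memLp_mul.restrict T).star⟩

lemma integrableOn_deriv_mul (h : IsWeberSolution ν y y' T) (g : PCFormDomain) :
    IntegrableOn (fun x : ℝ => y' x * conj (g.wderiv x)
      + ((x : ℂ) ^ 2 / 4 - 1 / 2 - ν) * y x * conj (g.toFun x)) T := by
  obtain ⟨i1, _, i3, i4⟩ := h.integrable_pairings g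
  refine (i3.add ((i4.const_mul (1 / 4)).sub (i1.const_mul (1 / 2 + ν)))).congr
    (Filter.Eventually.of_forall fun x => ?_)
  simp only [Pi.add_apply, Pi.sub_apply, map_mul, Complex.conj_ofReal]
  ring

/-- The weak derivative of `y' conj g`, rewritten with the Weber equation, is the integrand of the
unperturbed form minus `ν y conj g`. Integrating it leaves only a boundary term. -/
lemma hasWeakDerivative_mul (h : IsWeberSolution ν y y' T) (g : PCFormDomain) :
    HasWeakDerivative (fun x => y' x * conj (g.toFun x)) (fun x : ℝ => y' x * conj (g.wderiv x)
      + ((x : ℂ) ^ 2 / 4 - 1 / 2 - ν) * y x * conj (g.toFun x)) :=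
  g.hasWeakDerivative.conj.smooth_mul
    (g.memLp_toFun.star.locallyIntegrable (by norm_num))
    (g.memLp_wderiv.star.locallyIntegrable (by norm_num)) h.contDiff' h.hasDerivAt'

lemma locallyIntegrable_deriv_mul (h : IsWeberSolution ν y y' T) (g : PCFormDomain) :
    LocallyIntegrable (fun x : ℝ => y' x * conj (g.wderiv x)
      + ((x : ℂ) ^ 2 / 4 - 1 / 2 - ν) * y x * conj (g.toFun x)) := by
  refine LocallyIntegrable.add ?_ ?_
  · have := (g.memLp_wderiv.star.locallyIntegrable (by norm_num)).locallyIntegrableOn Set.univ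
    exact locallyIntegrableOn_univ.1
      (this.continuousOn_mul h.contDiff'.continuous.continuousOn isOpen_univ.isLocallyClosed)
  · refine Continuous.locallyIntegrable ?_
    have := h.contDiff.continuous
    have := g.continuous_toFun
    have : Continuous fun x => conj (g.toFun x) := Complex.continuous_conj.comp this
    fun_prop

lemma form_eq (h : IsWeberSolution ν y y' T) (g : PCFormDomain) {B : ℂ}
    (hB : ∫ x in T, (y' x * conj (g.wderiv x)
      + ((x : ℂ) ^ 2 / 4 - 1 / 2 - ν) * y x * conj (g.toFun x)) = B) :
    (∫ x in T, y' x * conj (g.wderiv x))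
      + 1 / 4 * (∫ x : ℝ in T, ((x : ℂ) * y x) * conj ((x : ℂ) * g.toFun x))
      - 1 / 2 * (∫ x in T, y x * conj (g.toFun x))
      = ν * (∫ x in T, y x * conj (g.toFun x)) + B := by
  obtain ⟨i1, _, i3, i4⟩ := h.integrable_pairings g
  have e1 := integral_sub (i4.const_mul (1 / 4)) (i1.const_mul (1 / 2 + ν))
  have e2 := integral_add i3 ((i4.const_mul (1 / 4)).sub (i1.const_mul (1 / 2 + ν)))
  rw [integral_const_mul, integral_const_mul] at e1
  have e3 : ∫ x in T, (y' x * conj (g.wderiv x)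
      + ((x : ℂ) ^ 2 / 4 - 1 / 2 - ν) * y x * conj (g.toFun x))
      = ∫ x : ℝ in T, (y' x * conj (g.wderiv x)
        + (1 / 4 * (((x : ℂ) * y x) * conj ((x : ℂ) * g.toFun x))
          - (1 / 2 + ν) * (y x * conj (g.toFun x)))) := by
    congr 1; ext x
    simp only [map_mul, Complex.conj_ofReal]
    ring
  rw [← hB, e3]
  have e2' := e2.trans (congrArg (_ + ·) e1)
  refine Eq.trans ?_ (congrArg (_ + ·) e2'.symm)
  ring

lemma form_eq_Ioi {s : ℝ} (h : IsWeberSolution ν y y' (Set.Ioi s)) (g : PCFormDomain) :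
    (∫ x in Set.Ioi s, y' x * conj (g.wderiv x))
      + 1 / 4 * (∫ x : ℝ in Set.Ioi s, ((x : ℂ) * y x) * conj ((x : ℂ) * g.toFun x))
      - 1 / 2 * (∫ x in Set.Ioi s, y x * conj (g.toFun x))
      = ν * (∫ x in Set.Ioi s, y x * conj (g.toFun x)) + -(y' s * conj (g.toFun s)) :=
  h.form_eq g ((h.hasWeakDerivative_mul g).integral_Ioi
    (h.contDiff'.continuous.mul (Complex.continuous_conj.comp g.continuous_toFun))
    (h.locallyIntegrable_deriv_mul g) (h.integrable_pairings g).2.1 (h.integrableOn_deriv_mul g))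

lemma form_eq_Iic {s : ℝ} (h : IsWeberSolution ν y y' (Set.Iic s)) (g : PCFormDomain) :
    (∫ x in Set.Iic s, y' x * conj (g.wderiv x))
      + 1 / 4 * (∫ x : ℝ in Set.Iic s, ((x : ℂ) * y x) * conj ((x : ℂ) * g.toFun x))
      - 1 / 2 * (∫ x in Set.Iic s, y x * conj (g.toFun x))
      = ν * (∫ x in Set.Iic s, y x * conj (g.toFun x)) + y' s * conj (g.toFun s) :=
  h.form_eq g ((h.hasWeakDerivative_mul g).integral_Iic
    (h.contDiff'.continuous.mul (Complex.continuous_conj.comp g.continuous_toFun))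
    (h.locallyIntegrable_deriv_mul g) (h.integrable_pairings g).2.1 (h.integrableOn_deriv_mul g))

end IsWeberSolution

/-! ### Gluing solutions and the matching condition. -/

lemma integral_Iic_add_Ioi_piecewise {s : ℝ} {F R L : ℝ → ℂ} (hR : IntegrableOn R (Set.Ioi s))
    (hL : IntegrableOn L (Set.Iic s)) (h1 : ∀ x ∈ Set.Ioi s, F x = R x)
    (h2 : ∀ x ∈ Set.Iic s, F x = L x) :
    ∫ x, F x = (∫ x in Set.Iic s, L x) + ∫ x in Set.Ioi s, R x := by
  rw [← setIntegral_congr_fun measurableSet_Ioi h1, ← setIntegral_congr_fun measurableSet_Iic h2]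
  exact (intervalIntegral.integral_Iic_add_Ioi
    ((integrableOn_congr_fun h2 measurableSet_Iic).2 hL)
    ((integrableOn_congr_fun h1 measurableSet_Ioi).2 hR)).symm

open Classical in
-- The boundary terms at `s` from the two sides cancel because the values agree there; the
-- derivatives may jump.
lemma hasWeakDerivative_piecewise {s : ℝ} {R R' L L' : ℝ → ℂ} (hR : ContDiff ℝ ∞ R)
    (hL : ContDiff ℝ ∞ L) (hR' : ∀ x, HasDerivAt R (R' x) x) (hL' : ∀ x, HasDerivAt L (L' x) x)
    (h : R s = L s) :
    HasWeakDerivative ((Set.Ioi s).piecewise R L) ((Set.Ioi s).piecewise R' L') := by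
  intro φ hφ hc
  have dφ : ∀ x, HasDerivAt φ (deriv φ x) x := fun x =>
    (hφ.differentiable (by simp) x).hasDerivAt
  have hcφ' : Continuous (deriv φ) := hφ.continuous_deriv (by simp)
  have key : ∀ {K K' : ℝ → ℂ}, ContDiff ℝ ∞ K → (∀ x, HasDerivAt K (K' x) x) →
      Integrable (fun x => deriv φ x • K x) ∧ Integrable (fun x => φ x • K' x) ∧
      (∫ x in Set.Ioi s, deriv φ x • K x) + (∫ x in Set.Ioi s, φ x • K' x) = -(φ s • K s) ∧
      (∫ x in Set.Iic s, deriv φ x • K x) + (∫ x in Set.Iic s, φ x • K' x) = φ s • K s := by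
    intro K K' hK hK'
    have hKc' : Continuous K' := by
      rw [show K' = deriv K from funext fun x => (hK' x).deriv.symm]
      exact hK.continuous_deriv (by simp)
    have i1 : Integrable (fun x => deriv φ x • K x) :=
      (hcφ'.smul hK.continuous).integrable_of_hasCompactSupport hc.deriv.smul_right
    have i2 : Integrable (fun x => φ x • K' x) :=
      (hφ.continuous.smul hKc').integrable_of_hasCompactSupport hc.smul_right
    have hd : deriv (fun x => φ x • K x) = fun x => deriv φ x • K x + φ x • K' x := by
      ext x
      rw [((dφ x).fun_smul (hK' x)).deriv, add_comm]
    have hcd : ContDiff ℝ 1 (fun x => φ x • K x) := (hφ.smul hK).of_le (by simp)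
    have hcs : HasCompactSupport (fun x => φ x • K x) := hc.smul_right
    refine ⟨i1, i2, ?_, ?_⟩
    · rw [← integral_add i1.integrableOn i2.integrableOn]
      exact (congrArg (fun F => ∫ x in Set.Ioi s, F x) hd).symm.trans
        (hcs.integral_Ioi_deriv_eq hcd s)
    · rw [← integral_add i1.integrableOn i2.integrableOn]
      exact (congrArg (fun F => ∫ x in Set.Iic s, F x) hd).symm.trans
        (hcs.integral_Iic_deriv_eq hcd s)
  obtain ⟨a1, a2, a3, -⟩ := key hR hR'
  obtain ⟨b1, b2, -, b4⟩ := key hL hL'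
  rw [integral_Iic_add_Ioi_piecewise (s := s) a1.integrableOn b1.integrableOn
      (fun x hx => by rw [Set.piecewise_eq_of_mem _ _ _ hx])
      (fun x hx => by rw [Set.piecewise_eq_of_notMem _ _ _ (by simpa using hx)]),
    integral_Iic_add_Ioi_piecewise (s := s) a2.integrableOn b2.integrableOn
      (fun x hx => by rw [Set.piecewise_eq_of_mem _ _ _ hx])
      (fun x hx => by rw [Set.piecewise_eq_of_notMem _ _ _ (by simpa using hx)])]
  rw [h] at a3
  linear_combination a3 + b4

open Classical in
/-- Two Weber solutions glued at `s`, as an element of the form domain. -/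
noncomputable def PCFormDomain.glue {ν : ℂ} {s : ℝ} {R R' L L' : ℝ → ℂ}
    (hR : IsWeberSolution ν R R' (Set.Ioi s)) (hL : IsWeberSolution ν L L' (Set.Iic s))
    (h : R s = L s) : PCFormDomain where
  toFun := (Set.Ioi s).piecewise R L
  wderiv := (Set.Ioi s).piecewise R' L'
  continuous_toFun := hR.contDiff.continuous.piecewise (fun x hx => by
    rw [frontier_Ioi, Set.mem_singleton_iff] at hx
    rw [hx, h]) hL.contDiff.continuous
  hasWeakDerivative := hasWeakDerivative_piecewise hR.contDiff hL.contDiff hR.hasDerivAt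
    hL.hasDerivAt h
  memLp_toFun := hR.memLp.piecewise measurableSet_Ioi (by rw [Set.compl_Ioi]; exact hL.memLp)
  memLp_wderiv := hR.memLp'.piecewise measurableSet_Ioi (by rw [Set.compl_Ioi]; exact hL.memLp')
  memLp_mul := by
    refine (hR.memLp_mul.piecewise (g := fun x : ℝ => (x : ℂ) * L x) measurableSet_Ioi
      (by rw [Set.compl_Ioi]; exact hL.memLp_mul)).ae_eq (Filter.Eventually.of_forall fun x => ?_)
    by_cases hx : x ∈ Set.Ioi s
    · simp only [Set.piecewise_eq_of_mem _ _ _ hx]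
    · simp only [Set.piecewise_eq_of_notMem _ _ _ hx]

section Glue

variable {ν : ℂ} {s : ℝ} {R R' L L' : ℝ → ℂ} (hR : IsWeberSolution ν R R' (Set.Ioi s))
  (hL : IsWeberSolution ν L L' (Set.Iic s)) (h : R s = L s)

lemma PCFormDomain.glue_of_lt {x : ℝ} (hx : s < x) : (PCFormDomain.glue hR hL h).toFun x = R x :=
  Set.piecewise_eq_of_mem _ _ _ hx

lemma PCFormDomain.glue_of_le {x : ℝ} (hx : x ≤ s) : (PCFormDomain.glue hR hL h).toFun x = L x :=
  Set.piecewise_eq_of_notMem _ _ _ (by simpa using hx)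

/-- The two half-line boundary terms add up to the jump of the derivative, which acts as a delta at
`s`. -/
lemma pcForm_glue (z : ℂ) (b : ℝ) (g : PCFormDomain) :
    pcForm z b (.glue hR hL h) g
      = ν * (∫ x, (PCFormDomain.glue hR hL h).toFun x * conj (g.toFun x))
        + (L' s - R' s) * conj (g.toFun s)
        + z * ((PCFormDomain.glue hR hL h).toFun b * conj (g.toFun b)
          - (PCFormDomain.glue hR hL h).toFun (-b) * conj (g.toFun (-b))) := by
  obtain ⟨r1, -, r3, r4⟩ := hR.integrable_pairings g
  obtain ⟨l1, -, l3, l4⟩ := hL.integrable_pairings g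
  have er := hR.form_eq_Ioi g
  have el := hL.form_eq_Iic g
  have t1 : ∀ x ∈ Set.Ioi s, (PCFormDomain.glue hR hL h).toFun x = R x := fun x hx =>
    PCFormDomain.glue_of_lt hR hL h hx
  have t2 : ∀ x ∈ Set.Iic s, (PCFormDomain.glue hR hL h).toFun x = L x := fun x hx =>
    PCFormDomain.glue_of_le hR hL h hx
  have w1 : ∀ x ∈ Set.Ioi s, (PCFormDomain.glue hR hL h).wderiv x = R' x := fun x hx =>
    Set.piecewise_eq_of_mem _ _ _ hx
  have w2 : ∀ x ∈ Set.Iic s, (PCFormDomain.glue hR hL h).wderiv x = L' x := fun x hx =>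
    Set.piecewise_eq_of_notMem _ _ _ (by simpa using hx)
  rw [pcForm, integral_Iic_add_Ioi_piecewise r3 l3 (fun x hx => by rw [w1 x hx])
      (fun x hx => by rw [w2 x hx]),
    integral_Iic_add_Ioi_piecewise r4 l4 (fun x hx => by rw [t1 x hx])
      (fun x hx => by rw [t2 x hx]),
    integral_Iic_add_Ioi_piecewise r1 l1 (fun x hx => by rw [t1 x hx])
      (fun x hx => by rw [t2 x hx])]
  linear_combination er + el

end Glue

/-- Passage from the form to the operator. A nonzero value of the continuous representative suffices
for a nonzero `L²` class. -/
lemma isEigenvalue_pcOperator {z ν : ℂ} {b : ℝ} (f : PCFormDomain) (hne : ∃ x, f.toFun x ≠ 0)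
    (hf : ∀ g : PCFormDomain, pcForm z b f g = ν * ∫ x, f.toFun x * conj (g.toFun x)) :
    IsEigenvalue (pcOperator z b) ν := by
  set u := f.memLp_toFun.toLp f.toFun with hu
  have hu' : (u : ℝ → ℂ) =ᵐ[volume] f.toFun := f.memLp_toFun.coeFn_toLp
  have hmem : (u, ν • u) ∈ (pcOperator z b).graph := by
    rw [pcOperator_graph]
    refine ⟨f, hu', fun g => ?_⟩
    rw [hf, ← integral_const_mul]
    refine integral_congr_ae ?_
    filter_upwards [Lp.coeFn_smul ν u, hu'] with x h1 h2
    change (ν • u : Lp ℂ 2 volume) x * _ = _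
    rw [h1, Pi.smul_apply, h2, smul_eq_mul, mul_assoc]
  obtain ⟨v, hv, hv'⟩ := (LinearPMap.mem_graph_iff _).1 hmem
  have hv : (v : Lp ℂ 2 (volume : Measure ℝ)) = u := hv
  have hv' : pcOperator z b v = ν • u := hv'
  refine ⟨v, ?_, by rw [hv', hv]⟩
  rw [hv]
  intro h0
  obtain ⟨x, hx⟩ := hne
  refine hx ?_
  have : f.toFun = fun _ => 0 := by
    refine (Continuous.ae_eq_iff_eq volume f.continuous_toFun continuous_const).mp ?_
    rw [h0] at hu'
    exact hu'.symm.trans (Lp.coeFn_zero ℂ 2 (volume : Measure ℝ))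
  rw [this]

/-- If `y` is a solution of the Weber equation that is square integrable at `+∞`, the vanishing of
the determinant of the matching conditions at `±b` makes `ν` an eigenvalue. -/
lemma isEigenvalue_of_matching {z ν : ℂ} {b : ℝ} (hb : 0 < b) {y y' : ℝ → ℂ}
    (hy : ∀ c, IsWeberSolution ν y y' (Set.Ioi c)) (hz : z ≠ 0) (hyb : y b ≠ 0) {w : ℂ}
    (hw : w = y' b * y (-b) + y b * y' (-b)) (hw0 : w ≠ 0)
    (hdet : w ^ 2 = z ^ 2 * (y b ^ 2 * (y (-b) ^ 2 - y b ^ 2))) :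
    IsEigenvalue (pcOperator z b) ν := by
  -- An unnormalised Green function with pole at `s`. Cross-multiplying by the values at `s` makes
  -- it continuous without division, so it stays meaningful when the Wronskian vanishes.
  let κ : ℝ → PCFormDomain := fun s =>
    .glue ((hy s).const_mul (y (-s))) ((hy (-s)).comp_neg.const_mul (y s)) (mul_comm _ _)
  have k1 : (κ b).toFun b = y b * y (-b) := PCFormDomain.glue_of_le _ _ _ le_rfl
  have k2 : (κ b).toFun (-b) = y b * y b := by
    refine (PCFormDomain.glue_of_le _ _ _ (by linarith)).trans ?_
    simp
  have k3 : (κ (-b)).toFun b = y b * y b := by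
    refine (PCFormDomain.glue_of_lt _ _ _ (by linarith)).trans ?_
    simp
  have k4 : (κ (-b)).toFun (-b) = y b * y (-b) := by
    refine (PCFormDomain.glue_of_le _ _ _ le_rfl).trans ?_
    simp [mul_comm]
  -- The derivative of `κ (±b)` jumps by `w`. With these coefficients the delta terms at `b` cancel
  -- identically; those at `-b` cancel exactly when `hdet` holds.
  set P := z * (y b * y b)
  set Q := w - z * (y b * y (-b))
  have hP : P ≠ 0 := mul_ne_zero hz (mul_ne_zero hyb hyb)
  let f := ((κ b).smul P).add ((κ (-b)).smul Q)
  have ev : ∀ x, f.toFun x = P * (κ b).toFun x + Q * (κ (-b)).toFun x := fun x => rfl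
  refine isEigenvalue_pcOperator f ⟨b, ?_⟩ fun g => ?_
  · intro h0
    rw [ev, k1, k3] at h0
    refine mul_ne_zero hP hw0 ?_
    -- The terms with `y (-b)` cancel, leaving `f(b) = w (y b)²`.
    simp only [P, Q] at h0 ⊢
    linear_combination z * h0
  · have hsplit : ∫ x, f.toFun x * conj (g.toFun x)
        = P * (∫ x, (κ b).toFun x * conj (g.toFun x))
          + Q * ∫ x, (κ (-b)).toFun x * conj (g.toFun x) := by
      rw [← integral_const_mul, ← integral_const_mul,
        ← integral_add ((integrable_mul_conj (κ b).memLp_toFun g.memLp_toFun).const_mul P)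
          ((integrable_mul_conj (κ (-b)).memLp_toFun g.memLp_toFun).const_mul Q)]
      refine integral_congr_ae (Filter.Eventually.of_forall fun x => ?_)
      simp only [ev]; ring
    have e1 := pcForm_glue ((hy b).const_mul (y (-b))) ((hy (-b)).comp_neg.const_mul (y b))
      (mul_comm _ _) z b g
    have e2 := pcForm_glue ((hy (-b)).const_mul (y (- -b)))
      ((hy (- -b)).comp_neg.const_mul (y (-b))) (mul_comm _ _) z b g
    change pcForm z b (κ b) g = ν * (∫ x, (κ b).toFun x * conj (g.toFun x)) + _
      + z * ((κ b).toFun b * _ - (κ b).toFun (-b) * _) at e1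
    change pcForm z b (κ (-b)) g = ν * (∫ x, (κ (-b)).toFun x * conj (g.toFun x)) + _
      + z * ((κ (-b)).toFun b * _ - (κ (-b)).toFun (-b) * _) at e2
    rw [k1, k2] at e1
    rw [k3, k4] at e2
    simp only [neg_neg] at e2
    rw [pcForm_add, pcForm_smul, pcForm_smul, e1, e2, hsplit]
    simp only [P, Q]
    rw [hw] at hdet ⊢
    linear_combination (-conj (g.toFun (-b))) * hdet

/-! ### Parity, and the decaying solution with its Gaussian bounds. -/

section HermiteParity
open Polynomial

lemma Polynomial.hermite_comp_neg_X (n : ℕ) : (hermite n).comp (-X) = C ((-1) ^ n) * hermite n := by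
  induction n with
  | zero => simp
  | succ n ih =>
    have hd := congrArg derivative ih
    rw [derivative_comp, derivative_C_mul] at hd
    simp only [derivative_neg, derivative_X] at hd
    rw [hermite_succ, sub_comp, mul_comp, X_comp, ih, pow_succ, C_mul]
    simp only [map_neg, map_one]
    linear_combination hd

lemma Polynomial.aeval_neg_hermite (n : ℕ) (x : ℝ) :
    aeval (-x) (hermite n) = (-1) ^ n * aeval x (hermite n) := by
  have h := congrArg (aeval x) (hermite_comp_neg_X n)
  simpa [aeval_comp] using h

end HermiteParity

lemma contDiff_weberU (k : ℕ) {s : ℂ} (hs : -(k : ℝ) < s.re) : ContDiff ℝ ∞ (weberU k s) := by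
  refine contDiff_infty.2 fun N => ?_
  induction N generalizing s with
  | zero =>
    exact contDiff_zero.2 (Differentiable.continuous (𝕜 := ℝ) fun x =>
      (hasDerivAt_weberU k hs x).differentiableAt)
  | succ N ih =>
    push_cast
    rw [contDiff_succ_iff_deriv]
    refine ⟨fun x => (hasDerivAt_weberU k hs x).differentiableAt, by simp, ?_⟩
    rw [funext fun x => (hasDerivAt_weberU k hs x).deriv]
    exact contDiff_const.mul (ih (by simp; linarith))

/-- The solution of `-y'' + (x²/4 - 1/2) y = ν y` decaying at `+∞`, for `Re ν < k`. -/
noncomputable def weberY (k : ℕ) (ν : ℂ) (x : ℝ) : ℂ :=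
  (Real.exp (-x ^ 2 / 4) : ℂ) * weberU k (-ν) x

/-- The derivative of `weberY`. -/
noncomputable def weberY' (k : ℕ) (ν : ℂ) (x : ℝ) : ℂ :=
  (Real.exp (-x ^ 2 / 4) : ℂ) * (ν * weberU k (-ν + 1) x - x / 2 * weberU k (-ν) x)

lemma hasDerivAt_gaussian (x : ℝ) :
    HasDerivAt (fun x : ℝ => (Real.exp (-x ^ 2 / 4) : ℂ))
      ((Real.exp (-x ^ 2 / 4) : ℂ) * -(x / 2)) x := by
  have h : HasDerivAt (fun x : ℝ => -x ^ 2 / 4) (-(x / 2)) x :=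
    (((hasDerivAt_id x).pow 2).neg.div_const 4).congr_deriv (by simp; ring)
  have := h.exp.ofReal_comp
  push_cast at this ⊢
  exact this

lemma contDiff_gaussian : ContDiff ℝ ∞ fun x : ℝ => (Real.exp (-x ^ 2 / 4) : ℂ) :=
  Complex.ofRealCLM.contDiff.comp
    (show ContDiff ℝ ∞ fun x : ℝ => Real.exp (-x ^ 2 / 4) by fun_prop)

lemma one_add_abs_pow_le (N : ℕ) (x : ℝ) :
    (1 + |x|) ^ N ≤ N.factorial * Real.exp 3 * Real.exp (x ^ 2 / 8) := by
  have h := Real.pow_div_factorial_le_exp (1 + |x|) (by positivity) N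
  rw [div_le_iff₀ (by positivity)] at h
  have h2 : Real.exp (1 + |x|) ≤ Real.exp 3 * Real.exp (x ^ 2 / 8) := by
    rw [← Real.exp_add]
    refine Real.exp_le_exp.2 ?_
    -- From `(|x| - 4)² ≥ 0` one gets `|x| ≤ x²/8 + 2`. Half of the Gaussian decay is spent on
    -- absorbing polynomial growth.
    nlinarith [sq_nonneg (|x| - 4), sq_abs x]
  calc _ ≤ _ := h
    _ ≤ (Real.exp 3 * Real.exp (x ^ 2 / 8)) * N.factorial := by gcongr
    _ = _ := by ring

lemma norm_gaussian_mul_le {F : ℂ} {C : ℝ} {N : ℕ} {x : ℝ} (hC : 0 ≤ C)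
    (h : ‖F‖ ≤ C * (1 + |x|) ^ N) :
    ‖(Real.exp (-x ^ 2 / 4) : ℂ) * F‖ ≤ C * (N.factorial * Real.exp 3) * Real.exp (-(1 / 8) * x ^ 2) := by
  rw [norm_mul, Complex.norm_real, Real.norm_of_nonneg (Real.exp_pos _).le]
  have e : Real.exp (-(1 / 8) * x ^ 2) = Real.exp (-x ^ 2 / 4) * Real.exp (x ^ 2 / 8) := by
    rw [← Real.exp_add]; congr 1; ring
  rw [e]
  calc _ ≤ Real.exp (-x ^ 2 / 4) * (C * (N.factorial * Real.exp 3 * Real.exp (x ^ 2 / 8))) := by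
        gcongr
        exact h.trans (by gcongr; exact one_add_abs_pow_le N x)
    _ = _ := by ring

lemma weberY_bound {k : ℕ} {ν₀ : ℂ} (hν : ν₀.re < k) (c : ℝ) :
    ∃ C : ℝ, 0 ≤ C ∧ ∀ᶠ ν in nhds ν₀, ∀ x, c ≤ x →
      ‖weberY k ν x‖ ≤ C * Real.exp (-(1 / 8) * x ^ 2) := by
  obtain ⟨C, hC, h⟩ := weberU_bound k c (s₀ := -ν₀) (by simpa using hν)
  refine ⟨C * (k.factorial * Real.exp 3), by positivity, ?_⟩
  filter_upwards [continuous_neg.continuousAt.eventually h] with ν hν x hx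
  exact norm_gaussian_mul_le hC (hν x hx)

lemma memLp_of_gaussian_bound {F : ℝ → ℂ} (hF : Continuous F) {c C : ℝ}
    (h : ∀ x, c ≤ x → ‖F x‖ ≤ C * Real.exp (-(1 / 8) * x ^ 2)) :
    MemLp F 2 (volume.restrict (Set.Ioi c)) := by
  have hg : MemLp (fun x : ℝ => C * Real.exp (-(1 / 8) * x ^ 2)) 2 (volume.restrict (Set.Ioi c)) := by
    refine MemLp.const_mul ?_ C
    refine MemLp.restrict _ ((memLp_two_iff_integrable_sq (by fun_prop)).2 ?_)
    refine (integrable_exp_neg_mul_sq (b := 1 / 4) (by norm_num)).congr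
      (Filter.Eventually.of_forall fun x => ?_)
    simp only
    rw [← Real.exp_nat_mul]
    congr 1; push_cast; ring
  refine hg.of_le hF.aestronglyMeasurable ?_
  filter_upwards [ae_restrict_mem measurableSet_Ioi] with x hx
  exact (h x (le_of_lt hx)).trans (le_abs_self _)

lemma isWeberSolution_weberY {k : ℕ} {ν : ℂ} (hν : ν.re < k) (c : ℝ) :
    IsWeberSolution ν (weberY k ν) (weberY' k ν) (Set.Ioi c) := by
  have h0 : -(k : ℝ) < (-ν).re := by simpa using hν
  have h1 : -(k : ℝ) < (-ν + 1).re := by simp; linarith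
  have hx : ContDiff ℝ ∞ fun x : ℝ => (x : ℂ) := Complex.ofRealCLM.contDiff
  have cd : ContDiff ℝ ∞ (weberY k ν) := contDiff_gaussian.mul (contDiff_weberU k h0)
  have cd' : ContDiff ℝ ∞ (weberY' k ν) := contDiff_gaussian.mul
    ((contDiff_const.mul (contDiff_weberU k h1)).sub ((hx.div_const 2).mul (contDiff_weberU k h0)))
  obtain ⟨C₀, p₀, e₀⟩ := weberU_bound k c h0
  obtain ⟨C₁, p₁, e₁⟩ := weberU_bound k c h1
  have e₀ := e₀.self_of_nhds
  have e₁ := e₁.self_of_nhds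
  refine ⟨cd, cd', fun x => ?_, fun x => ?_, ?_, ?_, ?_⟩
  · refine ((hasDerivAt_gaussian x).mul (hasDerivAt_weberU k h0 x)).congr_deriv ?_
    simp only [weberY']; ring
  · have d := (hasDerivAt_gaussian x).mul
      (((hasDerivAt_weberU k h1 x).const_mul ν).sub
        ((((hasDerivAt_id x).ofReal_comp).div_const 2).mul (hasDerivAt_weberU k h0 x)))
    refine d.congr_deriv ?_
    have r := weberU_recurrence k h0 x
    rw [show -ν + 2 = -ν + 1 + 1 by ring] at r
    simp only [weberY, id, Complex.ofReal_one, Pi.sub_apply, Pi.mul_apply]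
    linear_combination (Real.exp (-x ^ 2 / 4) : ℂ) * ν * r
  · exact memLp_of_gaussian_bound cd.continuous fun x hx => norm_gaussian_mul_le p₀ (e₀ x hx)
  · refine memLp_of_gaussian_bound cd'.continuous (C := (‖ν‖ * C₁ + C₀) * ((k + 1).factorial * Real.exp 3))
      fun x hx => norm_gaussian_mul_le (by positivity) ?_
    have hx0 := abs_nonneg x
    calc _ ≤ ‖ν‖ * ‖weberU k (-ν + 1) x‖ + |x| / 2 * ‖weberU k (-ν) x‖ := by
          refine (norm_sub_le _ _).trans ?_
          simp
      _ ≤ ‖ν‖ * (C₁ * (1 + |x|) ^ k) + |x| / 2 * (C₀ * (1 + |x|) ^ k) := by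
          gcongr
          · exact e₁ x hx
          · exact e₀ x hx
      _ ≤ (‖ν‖ * (C₁ * (1 + |x|) ^ k)) * (1 + |x|) + (1 + |x|) * (C₀ * (1 + |x|) ^ k) := by
          refine add_le_add (le_mul_of_one_le_right (by positivity) (by linarith)) ?_
          gcongr; linarith
      _ = _ := by ring
  · refine memLp_of_gaussian_bound (hx.continuous.mul cd.continuous)
      (C := C₀ * ((k + 1).factorial * Real.exp 3)) fun x hx => ?_
    have : (x : ℂ) * weberY k ν x = (Real.exp (-x ^ 2 / 4) : ℂ) * (x * weberU k (-ν) x) := by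
      simp only [weberY]; ring
    refine (congrArg norm this).trans_le (norm_gaussian_mul_le p₀ ?_)
    have hx0 := abs_nonneg x
    rw [norm_mul, Complex.norm_real, Real.norm_eq_abs, pow_succ]
    calc _ ≤ (1 + |x|) * (C₀ * (1 + |x|) ^ k) := by
          gcongr
          · linarith
          · exact e₀ x hx
      _ = _ := by ring

/-! ### Dependence of the decaying solution on `ν`. -/

/-- Lagrange's identity on a half-line. -/
lemma IsWeberSolution.lagrange {μ ν : ℂ} {y y' u u' : ℝ → ℂ} {c : ℝ}
    (hy : IsWeberSolution ν y y' (Set.Ioi c)) (hu : IsWeberSolution μ u u' (Set.Ioi c)) :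
    y' c * u c - y c * u' c = (ν - μ) * ∫ x in Set.Ioi c, y x * u x := by
  have hd : ∀ x, HasDerivAt (fun x => y' x * u x - y x * u' x) ((μ - ν) * (y x * u x)) x := by
    intro x
    refine (((hy.hasDerivAt' x).mul (hu.hasDerivAt x)).sub
      ((hy.hasDerivAt x).mul (hu.hasDerivAt' x))).congr_deriv ?_
    ring
  have i1 : IntegrableOn (fun x => (μ - ν) * (y x * u x)) (Set.Ioi c) :=
    (hy.memLp.integrable_mul hu.memLp).const_mul _
  have i2 : IntegrableOn (fun x => y' x * u x - y x * u' x) (Set.Ioi c) :=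
    (hy.memLp'.integrable_mul hu.memLp).sub (hy.memLp.integrable_mul hu.memLp')
  have lim := tendsto_zero_of_hasDerivAt_of_integrableOn_Ioi (fun x _ => hd x) i1 i2
  have := integral_Ioi_of_hasDerivAt_of_tendsto' (fun x _ => hd x) i1 lim
  rw [integral_const_mul] at this
  linear_combination this

lemma differentiableAt_weberY_left {k : ℕ} {ν : ℂ} (hν : ν.re < k) (x : ℝ) :
    DifferentiableAt ℂ (fun ν => weberY k ν x) ν := by
  have h := differentiableAt_weberU_left k (s := -ν) (by simpa using hν) x
  have : DifferentiableAt ℂ (fun ν => weberU k (-ν) x) ν :=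
    h.comp ν (f := fun ν => -ν) (by fun_prop)
  unfold weberY
  fun_prop

lemma differentiableAt_weberY'_left {k : ℕ} {ν : ℂ} (hν : ν.re < k) (x : ℝ) :
    DifferentiableAt ℂ (fun ν => weberY' k ν x) ν := by
  have h := differentiableAt_weberU_left k (s := -ν) (by simpa using hν) x
  have h0 : DifferentiableAt ℂ (fun ν => weberU k (-ν) x) ν :=
    h.comp ν (f := fun ν => -ν) (by fun_prop)
  have h' := differentiableAt_weberU_left k (s := -ν + 1) (by simp; linarith) x
  have h1 : DifferentiableAt ℂ (fun ν => weberU k (-ν + 1) x) ν :=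
    h'.comp ν (f := fun ν => -ν + 1) (by fun_prop)
  unfold weberY'
  fun_prop

lemma continuousAt_integral_weberY {k : ℕ} {μ : ℂ} (hμ : μ.re < k) (c : ℝ) :
    ContinuousAt (fun ν => ∫ x in Set.Ioi c, weberY k ν x * weberY k μ x) μ := by
  obtain ⟨C, hC, h⟩ := weberY_bound hμ c
  have hμ0 := isWeberSolution_weberY hμ c
  have hre : ∀ᶠ ν : ℂ in nhds μ, ν.re < k :=
    Complex.continuous_re.continuousAt.eventually_lt_const hμ
  refine continuousAt_of_dominated (bound := fun x => C * C * Real.exp (-(1 / 4) * x ^ 2)) ?_ ?_ ?_ ?_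
  · filter_upwards [hre] with ν hν
    exact ((isWeberSolution_weberY hν c).contDiff.continuous.mul
      hμ0.contDiff.continuous).aestronglyMeasurable
  · filter_upwards [h] with ν hν
    filter_upwards [ae_restrict_mem measurableSet_Ioi] with x hx
    have h1 := hν x (le_of_lt hx)
    have h2 := h.self_of_nhds x (le_of_lt hx)
    rw [norm_mul]
    calc _ ≤ (C * Real.exp (-(1 / 8) * x ^ 2)) * (C * Real.exp (-(1 / 8) * x ^ 2)) := by
          gcongr
      _ = C * C * (Real.exp (-(1 / 8) * x ^ 2) * Real.exp (-(1 / 8) * x ^ 2)) := by ring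
      _ = _ := by rw [← Real.exp_add]; congr 2; ring
  · exact ((integrable_exp_neg_mul_sq (by norm_num)).const_mul _).integrableOn
  · exact Filter.Eventually.of_forall fun x =>
      (differentiableAt_weberY_left hμ x).continuousAt.mul continuousAt_const

/-- The `ν`-derivative of the decaying solution at one of its zeros. -/
lemma deriv_weberY_left_mul {k : ℕ} {μ : ℂ} (hμ : μ.re < k) {c : ℝ} (hc : weberY k μ c = 0) :
    deriv (fun ν => weberY k ν c) μ * weberY' k μ c
      = -∫ x in Set.Ioi c, weberY k μ x * weberY k μ x := by
  have hre : ∀ᶠ ν : ℂ in nhds μ, ν.re < k :=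
    Complex.continuous_re.continuousAt.eventually_lt_const hμ
  have hs := hasDerivAt_iff_tendsto_slope.1 (differentiableAt_weberY_left hμ c).hasDerivAt
  refine tendsto_nhds_unique (hs.mul_const (weberY' k μ c)) ?_
  refine ((continuousAt_integral_weberY hμ c).tendsto.neg.mono_left nhdsWithin_le_nhds).congr' ?_
  filter_upwards [nhdsWithin_le_nhds hre, self_mem_nhdsWithin] with ν hν hne
  -- Since the solution for `μ` vanishes at `c`, Lagrange's identity divided by `ν - μ` turns the
  -- difference quotient into an integral.
  have hl := (isWeberSolution_weberY hν c).lagrange (isWeberSolution_weberY hμ c)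
  have hne : ν - μ ≠ 0 := sub_ne_zero.2 hne
  rw [hc] at hl
  rw [slope_def_field, hc]
  field_simp
  linear_combination hl

/-! ### Hermite functions: simple zeros and squared integrals. -/

/-- The real-valued eigenfunction `e^{-x²/4} He_n(x)`. -/
noncomputable def hermiteFun (n : ℕ) (x : ℝ) : ℝ :=
  Real.exp (-x ^ 2 / 4) * Polynomial.aeval x (Polynomial.hermite n)

lemma weberY_natCast {n k : ℕ} (hk : n < k) (x : ℝ) : weberY k n x = (hermiteFun n x : ℂ) := by
  rw [weberY, weberU_neg_nat hk, hermiteFun, Complex.ofReal_mul]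

lemma hermiteFun_neg (n : ℕ) (x : ℝ) : hermiteFun n (-x) = (-1) ^ n * hermiteFun n x := by
  rw [hermiteFun, hermiteFun, Polynomial.aeval_neg_hermite]
  ring_nf

lemma differentiable_hermiteFun (n : ℕ) : Differentiable ℝ (hermiteFun n) := by
  unfold hermiteFun
  have := (Polynomial.hermite n).differentiable_aeval (𝕜 := ℝ)
  fun_prop

lemma weberY'_natCast {n k : ℕ} (hk : n < k) (x : ℝ) :
    weberY' k n x = ((deriv (hermiteFun n) x : ℝ) : ℂ) := by
  have h1 := (isWeberSolution_weberY (k := k) (ν := n) (by simpa using hk) 0).hasDerivAt x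
  rw [funext (weberY_natCast hk)] at h1
  exact h1.unique (differentiable_hermiteFun n x).hasDerivAt.ofReal_comp

lemma deriv_hermiteFun_neg (n : ℕ) (x : ℝ) :
    deriv (hermiteFun n) (-x) = -(-1) ^ n * deriv (hermiteFun n) x := by
  have h1 := ((differentiable_hermiteFun n (-x)).hasDerivAt).scomp x (hasDerivAt_neg x)
  have h2 := (differentiable_hermiteFun n x).hasDerivAt.const_mul ((-1 : ℝ) ^ n)
  rw [← funext (hermiteFun_neg n)] at h2
  have := h1.unique h2
  simp only [smul_eq_mul] at this
  linear_combination -this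

/-- Consecutive Hermite polynomials have no common zero: by the recurrence such a zero would descend
to `He_0 = 1`. This gives simplicity of the zeros. -/
lemma weberU_neg_nat_ne_zero {k : ℕ} {x : ℝ} : ∀ {n : ℕ}, n < k →
    weberU k (-(n : ℂ)) x = 0 → (n : ℂ) * weberU k (-(n : ℂ) + 1) x ≠ 0 := by
  intro n
  induction n with
  | zero =>
    intro hk h
    rw [Nat.cast_zero, neg_zero, weberU_zero hk] at h
    exact absurd h one_ne_zero
  | succ n ih =>
    intro hk h h'
    have hk' : ((n : ℝ) + 1) < k := by exact_mod_cast hk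
    have e : (-((n + 1 : ℕ) : ℂ) + 1) = -(n : ℂ) := by push_cast; ring
    have e2 : (-((n + 1 : ℕ) : ℂ) + 2) = -(n : ℂ) + 1 := by push_cast; ring
    have r := weberU_recurrence k (s := -((n + 1 : ℕ) : ℂ)) (by simpa using hk') x
    rw [e] at h'
    have h0 : weberU k (-(n : ℂ)) x = 0 :=
      (mul_eq_zero.1 h').resolve_left (by exact_mod_cast Nat.succ_ne_zero n)
    rw [h, e, e2, h0] at r
    exact ih (by omega) h0 (by linear_combination r)

lemma deriv_hermiteFun_ne_zero {n : ℕ} {x : ℝ} (h : hermiteFun n x = 0) :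
    deriv (hermiteFun n) x ≠ 0 := by
  intro h'
  have hk : n < n + 1 := n.lt_succ_self
  have hE : (Real.exp (-x ^ 2 / 4) : ℂ) ≠ 0 := by exact_mod_cast (Real.exp_pos _).ne'
  have h1 := weberY_natCast hk x
  have h2 := weberY'_natCast hk x
  rw [h, weberY, Complex.ofReal_zero] at h1
  rw [h', weberY', Complex.ofReal_zero] at h2
  have h1 := (mul_eq_zero.1 h1).resolve_left hE
  have h2 := (mul_eq_zero.1 h2).resolve_left hE
  rw [h1, mul_zero, sub_zero] at h2
  exact weberU_neg_nat_ne_zero hk h1 h2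

lemma integrableOn_hermiteFun_sq (n : ℕ) (c : ℝ) :
    IntegrableOn (fun x => hermiteFun n x ^ 2) (Set.Ioi c) := by
  have h := (isWeberSolution_weberY (k := n + 1) (ν := n) (by simp) c).memLp
  have h2 := (memLp_two_iff_integrable_sq_norm h.aestronglyMeasurable).1 h
  refine h2.congr (Filter.Eventually.of_forall fun x => ?_)
  simp only [weberY_natCast n.lt_succ_self, Complex.norm_real, Real.norm_eq_abs, sq_abs]

lemma intervalIntegral_hermiteFun_sq_pos (n : ℕ) {c d : ℝ} (hcd : c < d) :
    0 < ∫ x in c..d, hermiteFun n x ^ 2 := by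
  refine intervalIntegral.integral_pos hcd
    ((differentiable_hermiteFun n).continuous.pow 2).continuousOn (fun x _ => sq_nonneg _) ?_
  by_contra! hcon
  have hz : ∀ x ∈ Set.Icc c d, hermiteFun n x = 0 := fun x hx =>
    pow_eq_zero_iff (two_ne_zero) |>.1 (le_antisymm (hcon x hx) (sq_nonneg _))
  -- Vanishing on an interval would give the monic polynomial `He_n` infinitely many roots.
  refine Polynomial.map_monic_ne_zero (f := Int.castRingHom ℝ) (Polynomial.hermite_monic n)
    (Polynomial.eq_zero_of_infinite_isRoot _ ((Set.Icc_infinite hcd).mono fun x hx => ?_))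
  have := hz x hx
  rw [hermiteFun, mul_eq_zero, or_iff_right (Real.exp_pos _).ne'] at this
  rw [Set.mem_ofPred_eq, Polynomial.IsRoot, Polynomial.eval_map]
  simpa [Polynomial.aeval_def] using this

lemma integral_hermiteFun_sq_split (n : ℕ) (c d : ℝ) :
    ∫ x in Set.Ioi c, hermiteFun n x ^ 2
      = (∫ x in c..d, hermiteFun n x ^ 2) + ∫ x in Set.Ioi d, hermiteFun n x ^ 2 :=
  (intervalIntegral.integral_interval_add_Ioi (integrableOn_hermiteFun_sq n c)
    (integrableOn_hermiteFun_sq n d)).symm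

lemma integral_hermiteFun_sq_pos (n : ℕ) (c : ℝ) : 0 < ∫ x in Set.Ioi c, hermiteFun n x ^ 2 := by
  rw [integral_hermiteFun_sq_split n c (c + 1)]
  have := intervalIntegral_hermiteFun_sq_pos n (lt_add_one c)
  have : 0 ≤ ∫ x in Set.Ioi (c + 1), hermiteFun n x ^ 2 := integral_nonneg fun x => sq_nonneg _
  linarith

/-! ### Non-real roots for large coupling. -/

/-- For `g` analytic at `0` with `g 0 > 0`, the equation `r² ε² g(ε) = -1` has two distinct
non-real solutions near `0` when `r` is large. -/
lemma exists_nonreal_roots {g : ℂ → ℂ} (hg : AnalyticAt ℂ g 0) {q : ℝ} (hq : 0 < q)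
    (hg0 : g 0 = q) {p : ℂ → Prop} (hp : ∀ᶠ ε in nhds 0, p ε) :
    ∃ δ : ℝ, 0 < δ ∧ ∀ r : ℝ, 1 / δ < r → ∃ ε₁ ε₂ : ℂ, ε₁ ≠ ε₂ ∧ ε₁.im ≠ 0 ∧ ε₂.im ≠ 0 ∧
      p ε₁ ∧ p ε₂ ∧ (r : ℂ) ^ 2 * (ε₁ ^ 2 * g ε₁) = -1 ∧ (r : ℂ) ^ 2 * (ε₂ ^ 2 * g ε₂) = -1 := by
  -- The equation reads `κ(ε)² = -1/r²`. As `κ'(0) = √q ≠ 0`, `κ` is locally invertible and the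
  -- roots are the preimages of `± i/r`.
  set κ : ℂ → ℂ := fun ε => ε * g ε ^ (2 : ℂ)⁻¹ with hκ
  have hslit : g 0 ∈ Complex.slitPlane := by
    rw [hg0]; exact Complex.ofReal_mem_slitPlane.2 hq
  have hroot : AnalyticAt ℂ (fun ε => g ε ^ (2 : ℂ)⁻¹) 0 := hg.cpow analyticAt_const hslit
  have hκ0 : κ 0 = 0 := by simp [hκ]
  set Q : ℝ := q ^ (2 : ℝ)⁻¹
  have hQ : 0 < Q := Real.rpow_pos_of_pos hq _
  have hgQ : g 0 ^ (2 : ℂ)⁻¹ = Q := by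
    rw [hg0, Complex.ofReal_cpow hq.le]; simp
  have hQ' : (Q : ℂ) ≠ 0 := by exact_mod_cast hQ.ne'
  have hd : HasStrictDerivAt κ Q 0 := by
    refine ((hasStrictDerivAt_id (0 : ℂ)).mul hroot.hasStrictDerivAt).congr_deriv ?_
    simp [hgQ]
  set φ := hd.localInverse κ Q 0 hQ'
  have hφd : HasStrictDerivAt φ (Q : ℂ)⁻¹ 0 := by
    have := hd.to_localInverse hQ'
    rwa [hκ0] at this
  have hright : ∀ᶠ w in nhds (0 : ℂ), κ (φ w) = w := by
    have := hd.eventually_right_inverse hQ'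
    rwa [hκ0] at this
  have hφ0 : φ 0 = 0 := by
    have h := (hd.eventually_left_inverse hQ').self_of_nhds
    rwa [hκ0] at h
  have hpφ : ∀ᶠ w in nhds (0 : ℂ), p (φ w) := by
    have := hφd.hasDerivAt.continuousAt.tendsto
    rw [hφ0] at this
    exact this.eventually hp
  -- The constant `Q⁻¹ / 2` keeps the error below half the size of the linear term, so the imaginary
  -- part of `φ(± i/r)` keeps its sign. The opposite signs also separate the two roots.
  have hball : ∀ᶠ w in nhds (0 : ℂ), ‖φ w - (Q : ℂ)⁻¹ * w‖ ≤ Q⁻¹ / 2 * ‖w‖ := by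
    have := (hasDerivAt_iff_isLittleO.1 hφd.hasDerivAt).def (c := Q⁻¹ / 2) (by positivity)
    simpa [hφ0, mul_comm] using this
  obtain ⟨δ, hδ, hall⟩ := Metric.eventually_nhds_iff.1 ((hright.and hpφ).and hball)
  refine ⟨δ, hδ, fun r hr => ?_⟩
  have hr0 : 0 < r := (by positivity : (0 : ℝ) < 1 / δ).trans hr
  have hrδ : r⁻¹ < δ := by
    rw [one_div] at hr; exact inv_lt_of_inv_lt₀ hδ hr
  have hsol : ∀ w : ℂ, ‖w‖ = r⁻¹ → w ^ 2 = -(r : ℂ)⁻¹ ^ 2 → p (φ w) ∧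
      (r : ℂ) ^ 2 * (φ w ^ 2 * g (φ w)) = -1 ∧ |(φ w).im - Q⁻¹ * w.im| ≤ Q⁻¹ / 2 * r⁻¹ := by
    intro w hw hw2
    obtain ⟨⟨h1, h2⟩, h3⟩ := hall (y := w) (by rw [dist_zero_right, hw]; exact hrδ)
    refine ⟨h2, ?_, ?_⟩
    · have e : φ w ^ 2 * g (φ w) = κ (φ w) ^ 2 := by
        rw [hκ]; simp only
        rw [mul_pow]
        congr 1
        exact (Complex.cpow_ofNat_inv_pow _ 2).symm
      have hrc : (r : ℂ) ≠ 0 := by exact_mod_cast hr0.ne'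
      rw [e, h1, hw2]
      field_simp
    · rw [hw] at h3
      refine le_trans ?_ h3
      refine le_trans (le_of_eq ?_) (Complex.abs_im_le_norm _)
      rw [← Complex.ofReal_inv, Complex.sub_im, Complex.im_ofReal_mul]
  have hQr : 0 < Q⁻¹ * r⁻¹ := by positivity
  obtain ⟨p1, s1, b1⟩ := hsol (((r⁻¹ : ℝ) : ℂ) * Complex.I) (by simp [abs_of_pos hr0])
    (by rw [mul_pow, Complex.I_sq]; push_cast; ring)
  obtain ⟨p2, s2, b2⟩ := hsol (-(((r⁻¹ : ℝ) : ℂ) * Complex.I)) (by simp [abs_of_pos hr0])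
    (by rw [neg_sq, mul_pow, Complex.I_sq]; push_cast; ring)
  rw [Complex.im_ofReal_mul, Complex.I_im, mul_one, abs_le] at b1
  rw [Complex.neg_im, Complex.im_ofReal_mul, Complex.I_im, mul_one, abs_le] at b2
  have i1 : 0 < (φ (((r⁻¹ : ℝ) : ℂ) * Complex.I)).im := by nlinarith [b1.1]
  have i2 : (φ (-(((r⁻¹ : ℝ) : ℂ) * Complex.I))).im < 0 := by nlinarith [b2.2]
  exact ⟨_, _, fun h => by rw [h] at i1; linarith, i1.ne', i2.ne, p1, p2, s1, s2⟩

/-- The eigenvalues near `n` when `±b` are zeros of the `n`-th eigenfunction. -/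
lemma exists_nonreal_eigenvalues {b : ℝ} (hb : 0 < b) {n : ℕ} (hn : hermiteFun n b = 0) {ρ : ℝ}
    (hρ : 0 < ρ) :
    ∃ δ : ℝ, 0 < δ ∧ ∀ r : ℝ, 1 / δ < r →
      ∃ ν₁ ν₂ : ℂ, ν₁ ≠ ν₂ ∧ ν₁.im ≠ 0 ∧ ν₂.im ≠ 0 ∧
        IsEigenvalue (pcOperator (Complex.I * (r : ℂ)) b) ν₁ ∧
        IsEigenvalue (pcOperator (Complex.I * (r : ℂ)) b) ν₂ ∧
        ‖ν₁ - (n : ℂ)‖ < ρ ∧ ‖ν₂ - (n : ℂ)‖ < ρ := by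
  -- Continuation to `Re ν < n + 1` is just enough to cover a neighbourhood of `n`.
  have hk : n < n + 1 := n.lt_succ_self
  have hnre : (n : ℂ).re < ((n + 1 : ℕ) : ℝ) := by simp
  set σ : ℝ := (-1) ^ n
  have hσ : σ * σ = 1 := by rw [← pow_add, ← two_mul, pow_mul]; simp
  set d : ℝ := deriv (hermiteFun n) b with hd
  have hd0 : d ≠ 0 := deriv_hermiteFun_ne_zero hn
  set I₁ : ℝ := ∫ x in Set.Ioi b, hermiteFun n x ^ 2 with hI₁
  set I₂ : ℝ := ∫ x in Set.Ioi (-b), hermiteFun n x ^ 2 with hI₂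
  have hI₁pos : 0 < I₁ := integral_hermiteFun_sq_pos n b
  have hI₁₂ : I₁ < I₂ := by
    have := intervalIntegral_hermiteFun_sq_pos n (show -b < b by linarith)
    rw [hI₂, integral_hermiteFun_sq_split n (-b) b]
    linarith
  have hnb : hermiteFun n (-b) = 0 := by rw [hermiteFun_neg, hn, mul_zero]
  let A : ℂ → ℂ := fun ν => weberY (n + 1) ν b
  let C : ℂ → ℂ := fun ν => weberY (n + 1) ν (-b)
  let A' : ℂ → ℂ := fun ν => weberY' (n + 1) ν b
  let C' : ℂ → ℂ := fun ν => weberY' (n + 1) ν (-b)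
  let U : Set ℂ := {ν | ν.re < ((n + 1 : ℕ) : ℝ)}
  have hU : IsOpen U := isOpen_lt Complex.continuous_re continuous_const
  have hnU : U ∈ nhds (n : ℂ) := hU.mem_nhds hnre
  have hA0 : A n = 0 := by change weberY _ _ _ = 0; rw [weberY_natCast hk, hn, Complex.ofReal_zero]
  have hC0 : C n = 0 := by change weberY _ _ _ = 0; rw [weberY_natCast hk, hnb, Complex.ofReal_zero]
  have hA'0 : A' n = d := weberY'_natCast hk b
  have hC'0 : C' n = -σ * d := by
    refine (weberY'_natCast hk (-b)).trans ?_
    rw [deriv_hermiteFun_neg, Complex.ofReal_mul, Complex.ofReal_neg]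
  have hint : ∀ c, ∫ x in Set.Ioi c, weberY (n + 1) n x * weberY (n + 1) n x
      = ((∫ x in Set.Ioi c, hermiteFun n x ^ 2 : ℝ) : ℂ) := by
    intro c
    rw [← integral_complex_ofReal]
    simp only [weberY_natCast hk]
    congr 1; ext x; push_cast; ring
  have hdA : deriv A n * d = -I₁ := by
    have := deriv_weberY_left_mul hnre hA0
    rw [hint b] at this
    rw [← hA'0]; exact this
  have hdC : deriv C n * (-σ * d) = -I₂ := by
    have := deriv_weberY_left_mul hnre hC0
    rw [hint (-b)] at this
    rw [← hC'0]; exact this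
  have anal : ∀ {F : ℂ → ℂ}, (∀ ν ∈ U, DifferentiableAt ℂ F ν) →
      AnalyticAt ℂ (fun ε => F (n + ε)) 0 ∧ AnalyticAt ℂ (fun ε => dslope F n (n + ε)) 0 := by
    intro F hF
    have hF' : DifferentiableOn ℂ F U := fun ν hν => (hF ν hν).differentiableWithinAt
    have hshift : AnalyticAt ℂ (fun ε : ℂ => (n : ℂ) + ε) 0 := by fun_prop
    have h1 : AnalyticAt ℂ F ((n : ℂ) + 0) := by rw [add_zero]; exact hF'.analyticAt hnU
    have h2 : AnalyticAt ℂ (dslope F n) ((n : ℂ) + 0) := by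
      rw [add_zero]
      exact ((Complex.differentiableOn_dslope hnU).2 hF').analyticAt hnU
    exact ⟨h1.fun_comp hshift, h2.fun_comp hshift⟩
  obtain ⟨-, ana⟩ := anal (F := A) fun ν hν => differentiableAt_weberY_left hν b
  obtain ⟨-, anc⟩ := anal (F := C) fun ν hν => differentiableAt_weberY_left hν (-b)
  obtain ⟨anA', -⟩ := anal (F := A') fun ν hν => differentiableAt_weberY'_left hν b
  obtain ⟨anC', -⟩ := anal (F := C') fun ν hν => differentiableAt_weberY'_left hν (-b)
  -- Dividing the zero at `ν = n` out of `A` and `C` keeps both quotients analytic; their values at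
  -- `0` are the `ν`-derivatives.
  set a : ℂ → ℂ := fun ε => dslope A n (n + ε)
  set c : ℂ → ℂ := fun ε => dslope C n (n + ε)
  set w : ℂ → ℂ := fun ε => A' (n + ε) * c ε + a ε * C' (n + ε)
  have hwan : AnalyticAt ℂ w 0 := (anA'.mul anc).add (ana.mul anC')
  have hAa : ∀ ε, A (n + ε) = ε * a ε := fun ε => by
    have := sub_smul_dslope A n (n + ε)
    rw [hA0] at this
    simpa using this.symm
  have hCc : ∀ ε, C (n + ε) = ε * c ε := fun ε => by
    have := sub_smul_dslope C n (n + ε)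
    rw [hC0] at this
    simpa using this.symm
  have hdc : (d : ℂ) ≠ 0 := by exact_mod_cast hd0
  have hσc : (σ : ℂ) * σ = 1 := by exact_mod_cast hσ
  have ha0 : a 0 = ((-(I₁ / d) : ℝ) : ℂ) := by
    have : a 0 = deriv A n := by simp only [a, add_zero, dslope_same]
    rw [this]; push_cast
    field_simp
    linear_combination hdA
  have hc0 : c 0 = ((σ * (I₂ / d) : ℝ) : ℂ) := by
    have : c 0 = deriv C n := by simp only [c, add_zero, dslope_same]
    rw [this]; push_cast
    field_simp
    linear_combination (-σ : ℂ) * hdC - (deriv C n * d) * hσc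
  have hw0 : w 0 = ((σ * (I₁ + I₂) : ℝ) : ℂ) := by
    simp only [w, add_zero, hA'0, hC'0, ha0, hc0]
    push_cast
    field_simp
    ring
  have hσ0 : σ ≠ 0 := by rintro h; rw [h] at hσ; simp at hσ
  have ha0' : a 0 ≠ 0 := by
    rw [ha0, Complex.ofReal_ne_zero]
    exact neg_ne_zero.2 (div_ne_zero hI₁pos.ne' hd0)
  have hw0' : w 0 ≠ 0 := by
    rw [hw0, Complex.ofReal_ne_zero]
    exact mul_ne_zero hσ0 (by linarith)
  -- Positivity of `q` rests on `I₁ < I₂`. The predicate `p` collects the nonvanishing and domain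
  -- conditions needed for matching.
  obtain ⟨δ, hδ, h⟩ := exists_nonreal_roots
    (g := fun ε => a ε ^ 2 * (c ε ^ 2 - a ε ^ 2) / w ε ^ 2)
    (((ana.pow 2).mul ((anc.pow 2).sub (ana.pow 2))).div (hwan.pow 2) (pow_ne_zero 2 hw0'))
    (q := (I₁ / d) ^ 2 * ((I₂ ^ 2 - I₁ ^ 2) / d ^ 2) / (I₁ + I₂) ^ 2) (by
      have : 0 < I₂ ^ 2 - I₁ ^ 2 := by nlinarith
      have : 0 < I₁ + I₂ := by linarith
      positivity) (by
      simp only [ha0, hc0, hw0]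
      rw [← Complex.ofReal_pow, ← Complex.ofReal_pow, ← Complex.ofReal_pow, ← Complex.ofReal_sub,
        ← Complex.ofReal_mul, ← Complex.ofReal_div, Complex.ofReal_inj]
      have e : σ ^ 2 = 1 := by rw [sq, hσ]
      rw [mul_pow, mul_pow, e]
      field_simp)
    (p := fun ε => ‖ε‖ < ρ ∧ (n : ℂ) + ε ∈ U ∧ a ε ≠ 0 ∧ w ε ≠ 0)
    (by
      have e1 : ∀ᶠ ε : ℂ in nhds 0, ‖ε‖ < ρ :=
        continuous_norm.continuousAt.eventually_lt_const (by simpa using hρ)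
      have e2 : ∀ᶠ ε : ℂ in nhds 0, (n : ℂ) + ε ∈ U :=
        (show Continuous fun ε : ℂ => (n : ℂ) + ε by fun_prop).continuousAt.eventually
          (by simpa using hnU)
      exact e1.and (e2.and ((ana.continuousAt.eventually_ne ha0').and
        (hwan.continuousAt.eventually_ne hw0'))))
  refine ⟨δ, hδ, fun r hr => ?_⟩
  have hr0 : 0 < r := (by positivity : (0 : ℝ) < 1 / δ).trans hr
  have hz : Complex.I * (r : ℂ) ≠ 0 :=
    mul_ne_zero Complex.I_ne_zero (by exact_mod_cast hr0.ne')
  obtain ⟨ε₁, ε₂, hne, m1, m2, ⟨p1, q1, a1, w1⟩, ⟨p2, q2, a2, w2⟩, s1, s2⟩ := h r hr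
  have main : ∀ ε : ℂ, ε.im ≠ 0 → (n : ℂ) + ε ∈ U → a ε ≠ 0 → w ε ≠ 0 →
      (r : ℂ) ^ 2 * (ε ^ 2 * (a ε ^ 2 * (c ε ^ 2 - a ε ^ 2) / w ε ^ 2)) = -1 →
      IsEigenvalue (pcOperator (Complex.I * (r : ℂ)) b) (n + ε) := by
    intro ε him hεU ha hw hs
    have hε : ε ≠ 0 := by rintro rfl; simp at him
    have hyb : weberY (n + 1) (n + ε) b = ε * a ε := hAa ε
    have hyb' : weberY (n + 1) (n + ε) (-b) = ε * c ε := hCc ε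
    refine isEigenvalue_of_matching hb (y := weberY (n + 1) (n + ε)) (y' := weberY' (n + 1) (n + ε))
      (w := ε * w ε) (fun c => isWeberSolution_weberY hεU c) hz ?_ ?_ (mul_ne_zero hε hw) ?_
    · rw [hyb]; exact mul_ne_zero hε ha
    · rw [hyb, hyb']; simp only [w, A', C']; ring
    · rw [hyb, hyb', mul_pow Complex.I, Complex.I_sq]
      field_simp at hs
      linear_combination ε ^ 2 * hs
  refine ⟨n + ε₁, n + ε₂, fun h => hne (add_left_cancel h), by simpa using m1, by simpa using m2,
    main ε₁ m1 q1 a1 w1 s1, main ε₂ m2 q2 a2 w2 s2, by simpa using p1, by simpa using p2⟩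

/-! ### Hermite polynomials as terminating Weber series, and zeros of `D_n`. -/

section HermiteSeries
open Polynomial

lemma Polynomial.hermite_ode (n : ℕ) :
    derivative (derivative (hermite n)) - X * derivative (hermite n) + (n : ℤ[X]) * hermite n = 0 := by
  induction n with
  | zero => simp
  | succ n ih =>
    have h1 : derivative (hermite (n + 1)) = (n + 1 : ℤ[X]) * hermite n := by
      rw [hermite_succ, derivative_sub, derivative_mul, derivative_X]
      linear_combination -ih
    have h2 : derivative (derivative (hermite (n + 1))) = (n + 1 : ℤ[X]) * derivative (hermite n) := by
      rw [h1, derivative_mul]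
      simp
    rw [h2, h1, hermite_succ]
    push_cast; ring

lemma Polynomial.coeff_hermite_add_two (n j : ℕ) :
    ((j + 2 : ℤ) * (j + 1)) * (hermite n).coeff (j + 2) = (j - n) * (hermite n).coeff j := by
  have h := congrArg (fun p => p.coeff j) (hermite_ode n)
  have hX : (X * derivative (hermite n)).coeff j = (hermite n).coeff j * j := by
    cases j with
    | zero => simp
    | succ j => rw [coeff_X_mul, coeff_derivative]; push_cast; ring
  simp only [coeff_add, coeff_sub, coeff_derivative, hX, coeff_natCast_mul, coeff_zero] at h
  push_cast at h
  linear_combination h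

/-- The Hermite equation gives a two-step recursion for the coefficients, the same as that of the
even (`e = 0`) or odd (`e = 1`) Weber series. -/
lemma Polynomial.factorial_mul_coeff_hermite (n : ℕ) {e : ℕ} (he : e ≤ 1) (k : ℕ) :
    ((2 * k + e).factorial : ℤ) * (hermite n).coeff (2 * k + e)
      = (∏ j ∈ Finset.range k, (-(n : ℤ) + e + 2 * j)) * (hermite n).coeff e := by
  induction k with
  | zero => simp [Nat.factorial_eq_one.2 he]
  | succ k ih =>
    have h := coeff_hermite_add_two n (2 * k + e)
    rw [Finset.prod_range_succ, show 2 * (k + 1) + e = 2 * k + e + 2 by ring,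
      Nat.factorial_succ, Nat.factorial_succ]
    push_cast at h ⊢
    linear_combination ((2 * k + e).factorial : ℤ) * h + (-(n : ℤ) + e + 2 * k) * ih

lemma Finset.sum_range_two_mul {M : Type*} [AddCommMonoid M] (f : ℕ → M) (N : ℕ) :
    ∑ j ∈ Finset.range (2 * N), f j = ∑ k ∈ Finset.range N, (f (2 * k) + f (2 * k + 1)) := by
  induction N with
  | zero => simp
  | succ N ih =>
    rw [show 2 * (N + 1) = 2 * N + 1 + 1 by ring, Finset.sum_range_succ, Finset.sum_range_succ,
      Finset.sum_range_succ, ih, add_assoc]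

lemma aeval_hermite_eq_tsum {n m e : ℕ} (he : e ≤ 1) (hn : n = 2 * m + e) (x : ℝ) :
    ((aeval x (hermite n) : ℝ) : ℂ) = ((hermite n).coeff e : ℂ) *
      ∑' k : ℕ, (∏ j ∈ Finset.range k, (-(n : ℂ) + e + 2 * (j : ℂ))) * (x : ℂ) ^ (2 * k + e) /
        (Nat.factorial (2 * k + e) : ℂ) := by
  have hdeg : (hermite n).natDegree < 2 * (m + 1) := by rw [natDegree_hermite]; omega
  -- The factor with `j = m` is `-n + e + 2m = 0`, so the series terminates.
  rw [tsum_eq_sum (s := Finset.range (m + 1)) (fun k hk => by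
      rw [Finset.mem_range, not_lt] at hk
      rw [Finset.prod_eq_zero (i := m) (Finset.mem_range.2 (by omega)) (by rw [hn]; push_cast; ring)]
      simp), Finset.mul_sum, aeval_eq_sum_range' hdeg, Finset.sum_range_two_mul]
  push_cast
  refine Finset.sum_congr rfl fun k _ => ?_
  have hc := congrArg (Int.cast : ℤ → ℂ) (factorial_mul_coeff_hermite n he k)
  push_cast at hc
  have hf : (Nat.factorial (2 * k + e) : ℂ) ≠ 0 := by exact_mod_cast Nat.factorial_ne_zero _
  have key : ((hermite n).coeff (2 * k + e) : ℂ) * (x : ℂ) ^ (2 * k + e)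
      = ((hermite n).coeff e : ℂ) * ((∏ j ∈ Finset.range k, (-(n : ℂ) + e + 2 * (j : ℂ))) *
        (x : ℂ) ^ (2 * k + e) / (Nat.factorial (2 * k + e) : ℂ)) := by
    field_simp
    linear_combination (x : ℂ) ^ (2 * k + e) * hc
  rw [← key]
  interval_cases e
  · rw [coeff_hermite_of_odd_add (show Odd (n + (2 * k + 1)) from ⟨m + k, by omega⟩)]
    simp
  · rw [coeff_hermite_of_odd_add (show Odd (n + 2 * k) from ⟨m + k, by omega⟩)]
    simp

end HermiteSeries

lemma Complex.Gamma_half_sub_int_ne_zero (m : ℤ) : Complex.Gamma (1 / 2 - m) ≠ 0 := by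
  refine Complex.Gamma_ne_zero fun k h => ?_
  have h2 : (1 : ℂ) = ((2 * (m - k) : ℤ) : ℂ) := by push_cast; linear_combination 2 * h
  have h3 : (1 : ℤ) = 2 * (m - k) := by exact_mod_cast h2
  omega

/-- A zero of `D_n` is a zero of the `n`-th Hermite function. -/
lemma hermiteFun_eq_zero_of_parabolicCylinderD {n : ℕ} {x : ℝ}
    (h : parabolicCylinderD (n : ℂ) (x : ℂ) = 0) : hermiteFun n x = 0 := by
  have hπ : (Real.sqrt Real.pi : ℂ) ≠ 0 := by
    exact_mod_cast (Real.sqrt_pos.2 Real.pi_pos).ne'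
  have h2 : ∀ s : ℂ, (2 : ℂ) ^ s ≠ 0 := fun s => by simp [Complex.cpow_eq_zero_iff]
  rw [hermiteFun]
  refine mul_eq_zero_of_right _ ?_
  rw [← Complex.ofReal_eq_zero]
  obtain ⟨m, rfl | rfl⟩ := n.even_or_odd'
  · rw [aeval_hermite_eq_tsum (m := m) zero_le_one (add_zero (2 * m)).symm]
    refine mul_eq_zero_of_right _ ?_
    -- For even `n` the coefficient of `weberOdd` is killed by the pole of `Γ` at `-m`, while that
    -- of `weberEven` is nonzero; for odd `n` the roles are exchanged.
    have g1 : Complex.Gamma (-((2 * m : ℕ) : ℂ) / 2) = 0 := by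
      rw [show -((2 * m : ℕ) : ℂ) / 2 = -(m : ℂ) by push_cast; ring]
      exact Complex.Gamma_neg_nat_eq_zero m
    have g2 : Complex.Gamma (-((2 * m : ℕ) : ℂ) / 2 + 1 / 2) ≠ 0 := by
      rw [show -((2 * m : ℕ) : ℂ) / 2 + 1 / 2 = 1 / 2 - ((m : ℤ) : ℂ) by push_cast; ring]
      exact Complex.Gamma_half_sub_int_ne_zero m
    rw [parabolicCylinderD, g1, inv_zero, mul_zero, zero_mul, sub_zero, mul_eq_zero,
      or_iff_right (mul_ne_zero (mul_ne_zero (h2 _) hπ) (inv_ne_zero g2)), weberEven, mul_eq_zero,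
      or_iff_right (Complex.exp_ne_zero _)] at h
    simpa using h
  · rw [aeval_hermite_eq_tsum (m := m) le_rfl rfl]
    refine mul_eq_zero_of_right _ ?_
    have g1 : Complex.Gamma (-((2 * m + 1 : ℕ) : ℂ) / 2 + 1 / 2) = 0 := by
      rw [show -((2 * m + 1 : ℕ) : ℂ) / 2 + 1 / 2 = -(m : ℂ) by push_cast; ring]
      exact Complex.Gamma_neg_nat_eq_zero m
    have g2 : Complex.Gamma (-((2 * m + 1 : ℕ) : ℂ) / 2) ≠ 0 := by
      rw [show -((2 * m + 1 : ℕ) : ℂ) / 2 = 1 / 2 - ((m + 1 : ℤ) : ℂ) by push_cast; ring]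
      exact Complex.Gamma_half_sub_int_ne_zero (m + 1)
    rw [parabolicCylinderD, g1, inv_zero, mul_zero, zero_mul, zero_sub, neg_eq_zero, mul_eq_zero,
      or_iff_right (mul_ne_zero (mul_ne_zero (h2 _) hπ) (inv_ne_zero g2)), weberOdd, mul_eq_zero,
      or_iff_right (Complex.exp_ne_zero _)] at h
    simpa using h

theorem mainTheorem9 (b : ℝ) (hb : 0 < b) (n : ℕ)
    (hn : parabolicCylinderD (n : ℂ) (b : ℂ) = 0) (ρ : ℝ) (hρ : 0 < ρ) :
    ∃ δ : ℝ, 0 < δ ∧ ∀ r : ℝ, 1 / δ < r →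
      ∃ ν₁ ν₂ : ℂ, ν₁ ≠ ν₂ ∧ ν₁.im ≠ 0 ∧ ν₂.im ≠ 0 ∧
        IsEigenvalue (pcOperator (Complex.I * (r : ℂ)) b) ν₁ ∧
        IsEigenvalue (pcOperator (Complex.I * (r : ℂ)) b) ν₂ ∧
        ‖ν₁ - (n : ℂ)‖ < ρ ∧ ‖ν₂ - (n : ℂ)‖ < ρ :=
  exists_nonreal_eigenvalues hb (hermiteFun_eq_zero_of_parabolicCylinderD hn) hρ
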